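/- A two-sided matching instance consists of $m$ workers $W$, $n$ firms $F$, capacities $c_f\in\mathbb{N}_0$ for the firms, and values $v_{w,f}, v_{f,w}\in\mathbb{N}_0$ for all $(w,f)\in W\times F$. A (many-to-one) matching is a function $\mu: W\times F\to\{0,1\}$ with $\sum_{f}\mu(w,f)\le 1$ for every worker $w$ and $\sum_{w}\mu(w,f)\le c_f$ for every firm $f$. The utility of worker $w$ is $u_w(\mu)=\sum_{f} v_{w,f}\,\mu(w,f)$, that of firm $f$ is $u_f(\mu)=\sum_{w} v_{f,w}\,\mu(w,f)$, and the Nash welfare of $\mu$ is $\bigl(\prod_{i\in W\cup F}u_i(\mu)\bigr)^{1/(n+m)}$. A matching is Nash optimal if its Nash welfare is maximum among all matchings of the instance. Valuations are symmetric binary if for every pair $(w,f)$ either $v_{w,f}=v_{f,w}=1$ or $v_{w,f}=v_{f,w}=0$. **Theorem.** For symmetric binary valuations, a Nash optimal matching can be computed in polynomial time. That is, there are a single program (for a random access machine in which every addition, truncated subtraction, memory access and test costs one time unit) and a polynomial $p$ such that, on every instance with symmetric binary valuations, given as the list of $m$, $n$, the capacities and all values in binary, the program halts after at most $p(L)$ steps,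 where $L$ is the bit length of the input, and outputs the $0/1$ matrix of a Nash optimal matching of the instance. -/

import Mathlib

namespace NashMatching

/-! ## Two-sided matching instances and Nash welfare -/

/-- An instance of the two-sided matching problem with `m` workers and `n` firms. Firms have
additive valuations, so a firm's valuation is given by its values for single workers. -/
structure Instance where
  /-- number of workers -/
  m : ℕ
  /-- number of firms -/
  n : ℕ
  /-- capacity of each firm -/
  cap : Fin n → ℕ
  /-- `vW w f` is the value of worker `w` for firm `f` -/
  vW : Fin m → Fin n → ℕ
  /-- `vF f w` is the value of firm `f` for worker `w` -/
  vF : Fin n → Fin m → ℕ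

namespace Instance

variable (I : Instance)

/-- For every pair, both values are `1` or both values are `0`. -/
def SymmetricBinary : Prop :=
  ∀ (w : Fin I.m) (f : Fin I.n),
    (I.vW w f = 1 ∧ I.vF f w = 1) ∨ (I.vW w f = 0 ∧ I.vF f w = 0)

/-- Many-to-one matchings, as 0/1-valued functions on worker-firm pairs. -/
structure IsMatching (μ : Fin I.m → Fin I.n → ℕ) : Prop where
  zero_or_one : ∀ w f, μ w f = 0 ∨ μ w f = 1
  worker_le : ∀ w, ∑ f, μ w f ≤ 1
  firm_le : ∀ f, ∑ w, μ w f ≤ I.cap f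

/-- Utility of a worker. -/
def workerUtility (μ : Fin I.m → Fin I.n → ℕ) (w : Fin I.m) : ℕ :=
  ∑ f, I.vW w f * μ w f

/-- Utility of a firm. -/
def firmUtility (μ : Fin I.m → Fin I.n → ℕ) (f : Fin I.n) : ℕ :=
  ∑ w, I.vF f w * μ w f

/-- Nash social welfare: the geometric mean of the utilities of all workers and firms. -/
noncomputable def nashWelfare (μ : Fin I.m → Fin I.n → ℕ) : ℝ :=
  ((∏ w, (I.workerUtility μ w : ℝ)) * ∏ f, (I.firmUtility μ f : ℝ)) ^
    (1 / ((I.n : ℝ) + (I.m : ℝ)))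

/-- A matching whose Nash welfare is maximum among all matchings of the instance. -/
def NashOptimal (μ : Fin I.m → Fin I.n → ℕ) : Prop :=
  I.IsMatching μ ∧ ∀ ν, I.IsMatching ν → I.nashWelfare ν ≤ I.nashWelfare μ

/-- The input as a list of numbers: `m`, `n`, the capacities, the workers' valuations (worker by
worker) and the firms' valuations (firm by firm). -/
def encode : List ℕ :=
  [I.m, I.n] ++ List.ofFn I.cap
    ++ (List.ofFn fun w => List.ofFn fun f => I.vW w f).flatten
    ++ (List.ofFn fun f => List.ofFn fun w => I.vF f w).flatten

/-- A matching written out as its 0/1 matrix, worker by worker. -/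
def encodeMatching (μ : Fin I.m → Fin I.n → ℕ) : List ℕ :=
  (List.ofFn fun w => List.ofFn fun f => μ w f).flatten

end Instance

/-! ## Random access machines

The machine has finitely many (those named in the program) unbounded arrays of natural numbers with
indirect addressing. The arithmetic operations are addition and truncated subtraction; every
operation, memory access and test costs one time unit. There is no multiplication, so in `t` steps
numbers grow by at most `t` bits up to constants, and polynomial time for this machine is
polynomial time in the usual sense (Cook and Reckhow). -/

/-- Memory contents: `s a i` is the `i`-th cell of array `a`. -/
abbrev Store : Type := ℕ → ℕ → ℕ

/-- Expressions of the machine's programming language. -/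
inductive Expr : Type
  | const (k : ℕ) : Expr
  | read (a : ℕ) (i : Expr) : Expr
  | add (e₁ e₂ : Expr) : Expr
  | sub (e₁ e₂ : Expr) : Expr

/-- Value of an expression. -/
def Expr.val (s : Store) : Expr → ℕ
  | .const k => k
  | .read a i => s a (i.val s)
  | .add e₁ e₂ => e₁.val s + e₂.val s
  | .sub e₁ e₂ => e₁.val s - e₂.val s

/-- Time to evaluate an expression: one unit for each constant, memory read and operation. -/
def Expr.time : Expr → ℕ
  | .const _ => 1
  | .read _ i => i.time + 1
  | .add e₁ e₂ => e₁.time + e₂.time + 1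
  | .sub e₁ e₂ => e₁.time + e₂.time + 1

/-- Programs. `write a i e` stores the value of `e` in cell `i` of array `a`; the tests of `ite`
and `loop` (a while loop) ask whether the value of an expression is nonzero. -/
inductive Prog : Type
  | skip : Prog
  | write (a : ℕ) (i e : Expr) : Prog
  | seq (P Q : Prog) : Prog
  | ite (e : Expr) (P Q : Prog) : Prog
  | loop (e : Expr) (P : Prog) : Prog

/-- Replace the content of cell `i` of array `a` by `x`. -/
def Store.set (s : Store) (a i x : ℕ) : Store :=
  fun b j => if b = a ∧ j = i then x else s b j

/-- `Runs P s t s'`: started with memory `s`, the program `P` halts after exactly `t` time units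
with memory `s'`. -/
inductive Runs : Prog → Store → ℕ → Store → Prop
  | skip (s : Store) : Runs .skip s 1 s
  | write (s : Store) (a : ℕ) (i e : Expr) :
      Runs (.write a i e) s (i.time + e.time + 1) (s.set a (i.val s) (e.val s))
  | seq {P Q : Prog} {s s₁ s₂ : Store} {t₁ t₂ : ℕ} :
      Runs P s t₁ s₁ → Runs Q s₁ t₂ s₂ → Runs (.seq P Q) s (t₁ + t₂) s₂
  | ite_true {e : Expr} {P Q : Prog} {s s₁ : Store} {t : ℕ} :
      e.val s ≠ 0 → Runs P s t s₁ → Runs (.ite e P Q) s (e.time + 1 + t) s₁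
  | ite_false {e : Expr} {P Q : Prog} {s s₁ : Store} {t : ℕ} :
      e.val s = 0 → Runs Q s t s₁ → Runs (.ite e P Q) s (e.time + 1 + t) s₁
  | loop_done {e : Expr} {P : Prog} {s : Store} :
      e.val s = 0 → Runs (.loop e P) s (e.time + 1) s
  | loop_step {e : Expr} {P : Prog} {s s₁ s₂ : Store} {t₁ t₂ : ℕ} :
      e.val s ≠ 0 → Runs P s t₁ s₁ → Runs (.loop e P) s₁ t₂ s₂ →
      Runs (.loop e P) s (e.time + 1 + t₁ + t₂) s₂

/-- The machine is deterministic: final memory and running time are determined by the program and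
the initial memory. -/
theorem Runs.unique {P : Prog} {s s₁ s₂ : Store} {t₁ t₂ : ℕ}
    (h₁ : Runs P s t₁ s₁) (h₂ : Runs P s t₂ s₂) : t₁ = t₂ ∧ s₁ = s₂ := by
  induction h₁ generalizing t₂ s₂ with
  | skip s => cases h₂; exact ⟨rfl, rfl⟩
  | write s a i e => cases h₂; exact ⟨rfl, rfl⟩
  | seq _ _ ih₁ ih₂ =>
    cases h₂ with
    | seq h₃ h₄ =>
      obtain ⟨rfl, rfl⟩ := ih₁ h₃
      obtain ⟨rfl, rfl⟩ := ih₂ h₄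
      exact ⟨rfl, rfl⟩
  | ite_true he _ ih =>
    cases h₂ with
    | ite_true _ h₃ => obtain ⟨rfl, rfl⟩ := ih h₃; exact ⟨rfl, rfl⟩
    | ite_false he' _ => exact absurd he' he
  | ite_false he _ ih =>
    cases h₂ with
    | ite_true he' _ => exact absurd he he'
    | ite_false _ h₃ => obtain ⟨rfl, rfl⟩ := ih h₃; exact ⟨rfl, rfl⟩
  | loop_done he =>
    cases h₂ with
    | loop_done _ => exact ⟨rfl, rfl⟩
    | loop_step he' _ _ => exact absurd he he'
  | loop_step he _ _ ih₁ ih₂ =>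
    cases h₂ with
    | loop_done he' => exact absurd he' he
    | loop_step _ h₃ h₄ =>
      obtain ⟨rfl, rfl⟩ := ih₁ h₃
      obtain ⟨rfl, rfl⟩ := ih₂ h₄
      exact ⟨rfl, rfl⟩

/-- Initial memory: the input list in array `0`, all other cells `0`. -/
def inputStore (x : List ℕ) : Store :=
  fun a i => if a = 0 then x.getD i 0 else 0

/-- The output list `y` is read from array `1`, all further cells of which are `0`. -/
def HasOutput (s : Store) (y : List ℕ) : Prop :=
  ∀ i, s 1 i = y.getD i 0

/-- Length of the input in bits, the numbers being written in binary with separators. -/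
def bitSize (x : List ℕ) : ℕ :=
  (x.map fun k => Nat.size k + 1).sum

/-- The search problem with inputs in `D`, encoded by `enc`, and admissible answers `Sol a` on
input `a`, is solved by a single program within a number of steps polynomial in the input length. -/
def SolvableInPolyTime {α : Type} (D : Set α) (enc : α → List ℕ) (Sol : α → List ℕ → Prop) :
    Prop :=
  ∃ (P : Prog) (p : Polynomial ℕ), ∀ a ∈ D, ∃ (t : ℕ) (s : Store) (y : List ℕ),
    Runs P (inputStore (enc a)) t s ∧ t ≤ p.eval (bitSize (enc a)) ∧ HasOutput s y ∧ Sol a y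

end NashMatching

namespace NashMatching

/-! A matching is viewed as an assignment of workers to bins, one bin per firm and bin `n` for the
unmatched. With symmetric binary values and all workers matched along edges, every worker has
utility 1 and a firm's utility is its number of workers, so the product of bin sizes must be
maximized. The algorithm is a local search: if a firm `g` with free capacity is reachable from bin
`f` (a worker in one bin may step to any firm adjacent to it) and the load of `g` is smaller by at
least two, one worker is shifted along each step of a path from `f` to `g`. The offset `m + 2` on
the load of bin `n` makes matching another worker such an improvement too, so augmentation and
balancing are one procedure. Each shift lowers the sum of squared loads (`PathMoved.potential_lt`),
which starts below `(2m+3)^2`; hence polynomially many sweeps suffice.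

A stable assignment is optimal by a duality argument (`Feasible.prod_count_le`). Stability at `f` is
certified by a set of bins closed under steps. If some matching has nonzero Nash welfare, counting
on closed sets shows that the stable assignment matches all workers (`Feasible.lt_of_stableAt`) and
leaves no firm empty (`count_pos_of_stableAt`). Then firm `g` gets the price `log (l / (l - 1))`,
where `l` is the largest load of a bin whose certificate contains `g`, but at least 2. Prices do not
increase along edges, and a secant inequality for the logarithm (`log_sub_log_le`) bounds the change
of `log` of each bin size by price times change of size; summed over workers this is nonpositive.

Running time is handled syntactically: programs are written with counted loops whose bounds are sums
of constants, `m` and `n`, and `ForProg.runs_compile` gives a polynomial time bound for all of them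
at once. As loops cannot stop early, their invariants contain an alternative "already finished". -/

@[simp] theorem Store.set_self (s : Store) (a i x : ℕ) :
    (s.set a i x) a = Function.update (s a) i x := by
  funext j; simp [Store.set, Function.update_apply]

@[simp] theorem Store.set_of_ne (s : Store) {a b : ℕ} (h : b ≠ a) (i x : ℕ) :
    (s.set a i x) b = s b := by
  funext j; simp [Store.set, h]

/-! ## Programs with bounded loops only -/

/-- Programs whose loops run a counter (cell `0` of array `c`) from `0` up to a bound. -/
inductive ForProg : Type
  | skip : ForProg
  | write (a : ℕ) (i e : Expr) : ForProg
  | seq (P Q : ForProg) : ForProg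
  | ite (e : Expr) (P Q : ForProg) : ForProg
  | loop (c : ℕ) (e : Expr) (P : ForProg) : ForProg

/-- Sums of constants and of the first two input numbers. -/
def Expr.IsBound : Expr → Prop
  | .const _ => True
  | .read a i => a = 0 ∧ (i = .const 0 ∨ i = .const 1)
  | .add e₁ e₂ => e₁.IsBound ∧ e₂.IsBound
  | .sub _ _ => False

/-- The value of a bound when the first two input numbers are replaced by the variable. -/
noncomputable def Expr.boundPoly : Expr → Polynomial ℕ
  | .const k => Polynomial.C k
  | .read _ _ => Polynomial.X
  | .add e₁ e₂ => e₁.boundPoly + e₂.boundPoly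
  | .sub _ _ => 0

theorem Expr.IsBound.val_le {e : Expr} (h : e.IsBound) {s : Store} {B : ℕ}
    (h0 : s 0 0 ≤ B) (h1 : s 0 1 ≤ B) : e.val s ≤ e.boundPoly.eval B := by
  induction e with
  | const k => simp [Expr.val, boundPoly]
  | read a i _ =>
    obtain ⟨rfl, rfl | rfl⟩ := h <;> simpa [Expr.val, boundPoly]
  | add e₁ e₂ ih₁ ih₂ =>
    simpa [Expr.val, boundPoly] using add_le_add (ih₁ h.1) (ih₂ h.2)
  | sub e₁ e₂ => exact h.elim

theorem Expr.IsBound.val_congr {e : Expr} (h : e.IsBound) {s t : Store} (hst : s 0 = t 0) :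
    e.val s = e.val t := by
  induction e with
  | const k => rfl
  | read a i _ =>
    obtain ⟨rfl, rfl | rfl⟩ := h <;> simp [Expr.val, hst]
  | add e₁ e₂ ih₁ ih₂ => simp [Expr.val, ih₁ h.1, ih₂ h.2]
  | sub e₁ e₂ => exact h.elim

namespace ForProg

/-- Iterate `F` for the counter values `0, …, N - 1`. -/
def iter (F : Store → Store) (c : ℕ) (s : Store) : ℕ → Store
  | 0 => s.set c 0 0
  | i + 1 => (F (iter F c s i)).set c 0 (i + 1)

/-- Memory after execution of a program. -/
def eval : ForProg → Store → Store
  | .skip, s => s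
  | .write a i e, s => s.set a (i.val s) (e.val s)
  | .seq P Q, s => Q.eval (P.eval s)
  | .ite e P Q, s => if e.val s ≠ 0 then P.eval s else Q.eval s
  | .loop c e P, s => iter P.eval c s (e.val s)

/-- `P.Avoids b`: array `b` is never written. -/
def Avoids (b : ℕ) : ForProg → Prop
  | .skip => True
  | .write a _ _ => b ≠ a
  | .seq P Q => P.Avoids b ∧ Q.Avoids b
  | .ite _ P Q => P.Avoids b ∧ Q.Avoids b
  | .loop c _ P => b ≠ c ∧ P.Avoids b

/-- Loop bounds depend on the input only and loop counters are not written by loop bodies. -/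
def WellFormed : ForProg → Prop
  | .skip => True
  | .write _ _ _ => True
  | .seq P Q => P.WellFormed ∧ Q.WellFormed
  | .ite _ P Q => P.WellFormed ∧ Q.WellFormed
  | .loop c e P => e.IsBound ∧ P.Avoids c ∧ P.WellFormed

/-- Translation to general programs. -/
def compile : ForProg → Prog
  | .skip => .skip
  | .write a i e => .write a i e
  | .seq P Q => .seq P.compile Q.compile
  | .ite e P Q => .ite e P.compile Q.compile
  | .loop c e P => .seq (.write c (.const 0) (.const 0))
      (.loop (.sub e (.read c (.const 0)))
        (.seq P.compile (.write c (.const 0) (.add (.read c (.const 0)) (.const 1)))))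

/-- A bound of the running time. -/
noncomputable def cost : ForProg → Polynomial ℕ
  | .skip => 1
  | .write _ i e => Polynomial.C (i.time + e.time + 1)
  | .seq P Q => P.cost + Q.cost
  | .ite e P Q => Polynomial.C (e.time + 1) + P.cost + Q.cost
  | .loop _ e P => Polynomial.C (e.time + 7) +
      e.boundPoly * (P.cost + Polynomial.C (e.time + 10))

theorem eval_of_avoids {b : ℕ} {P : ForProg} (h : P.Avoids b) (s : Store) :
    P.eval s b = s b := by
  induction P generalizing s with
  | skip => rfl
  | write a i e => exact Store.set_of_ne _ h _ _
  | seq P Q ihP ihQ => simp [eval, ihQ h.2, ihP h.1]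
  | ite e P Q ihP ihQ =>
    simp only [eval]; split_ifs
    · exact ihP h.1 s
    · exact ihQ h.2 s
  | loop c e P ih =>
    have : ∀ k, iter P.eval c s k b = s b := by
      intro k
      induction k with
      | zero => exact Store.set_of_ne _ h.1 _ _
      | succ k ihk => simp [iter, Store.set_of_ne _ h.1, ih h.2, ihk]
    exact this _

/-- Array `0` is never written, so a loop bound keeps its value from the entry of the loop; the body
cannot touch the counter, so the number of rounds is known in advance. -/
theorem runs_compile {P : ForProg} (h : P.WellFormed) (h0 : P.Avoids 0) {s : Store} {B : ℕ}
    (hB0 : s 0 0 ≤ B) (hB1 : s 0 1 ≤ B) :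
    ∃ t, Runs P.compile s t (P.eval s) ∧ t ≤ P.cost.eval B := by
  induction P generalizing s with
  | skip => exact ⟨1, .skip s, by simp [cost]⟩
  | write a i e => exact ⟨_, .write s a i e, by simp [cost]⟩
  | seq P Q ihP ihQ =>
    obtain ⟨t₁, r₁, l₁⟩ := ihP h.1 h0.1 hB0 hB1
    have e0 := eval_of_avoids h0.1 s
    obtain ⟨t₂, r₂, l₂⟩ := ihQ (s := P.eval s) h.2 h0.2 (by rwa [e0]) (by rwa [e0])
    exact ⟨_, .seq r₁ r₂, by simpa [cost] using add_le_add l₁ l₂⟩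
  | ite e P Q ihP ihQ =>
    simp only [eval]
    split_ifs with he
    · obtain ⟨t, r, l⟩ := ihP h.1 h0.1 hB0 hB1
      exact ⟨_, .ite_true he r, by simp [cost]; omega⟩
    · obtain ⟨t, r, l⟩ := ihQ h.2 h0.2 hB0 hB1
      exact ⟨_, .ite_false (not_not.mp he) r, by simp [cost]; omega⟩
  | loop c e P ih =>
    obtain ⟨hb, hc, hw⟩ := h
    obtain ⟨hc0, hP0⟩ := h0
    set K := P.cost.eval B with hK
    have inv : ∀ k, iter P.eval c s k 0 = s 0 ∧ iter P.eval c s k c 0 = k := by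
      intro k
      induction k with
      | zero => simp [iter, Store.set_of_ne _ hc0]
      | succ k ihk => simp [iter, Store.set_of_ne _ hc0, eval_of_avoids hP0, ihk.1]
    -- Induction on the number `j` of remaining rounds. A successful test costs `e.time + 4` and the
    -- increment 6, besides the body; the last test costs `e.time + 4`.
    have main : ∀ j k, k + j = e.val s → ∃ t,
        Runs (.loop (.sub e (.read c (.const 0)))
          (.seq P.compile (.write c (.const 0) (.add (.read c (.const 0)) (.const 1)))))
          (iter P.eval c s k) t (iter P.eval c s (e.val s)) ∧
        t ≤ j * (K + (e.time + 10)) + (e.time + 4) := by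
      intro j
      induction j with
      | zero =>
        intro k hk
        obtain rfl : k = e.val s := by omega
        refine ⟨_, .loop_done ?_, ?_⟩
        · simp [Expr.val, (inv _).2, hb.val_congr (inv (e.val s)).1]
        · simp [Expr.time]
      | succ j ihj =>
        intro k hk
        obtain ⟨t₁, r₁, l₁⟩ := ih (s := iter P.eval c s k) hw hP0
          (by rwa [(inv k).1]) (by rwa [(inv k).1])
        obtain ⟨t₂, r₂, l₂⟩ := ihj (k + 1) (by omega)
        have hr : Runs (.write c (.const 0) (.add (.read c (.const 0)) (.const 1)))
            (P.eval (iter P.eval c s k)) 6 (iter P.eval c s (k + 1)) := by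
          have := Runs.write (P.eval (iter P.eval c s k)) c (.const 0)
            (.add (.read c (.const 0)) (.const 1))
          simpa [Expr.val, Expr.time, eval_of_avoids hc, (inv k).2, iter] using this
        refine ⟨_, .loop_step ?_ (.seq r₁ hr) r₂, ?_⟩
        · simp only [Expr.val, (inv k).2, hb.val_congr (inv k).1]; omega
        · simp only [Expr.time]
          rw [Nat.succ_mul]; omega
    obtain ⟨t, r, l⟩ := main (e.val s) 0 (by omega)
    refine ⟨_, .seq (.write _ _ _ _) r, ?_⟩
    have := Nat.mul_le_mul_right (K + (e.time + 10)) (hb.val_le hB0 hB1)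
    simp only [cost, Polynomial.eval_add, Polynomial.eval_mul, Polynomial.eval_C, Expr.time,
      ← hK]
    omega

/-- Rule for loops with an invariant. -/
theorem loop_induction {c : ℕ} {e : Expr} {P : ForProg} {s : Store} (N : ℕ) (hN : e.val s = N)
    (Inv : ℕ → Store → Prop) (h0 : Inv 0 (s.set c 0 0))
    (hstep : ∀ i < N, ∀ t, t c 0 = i →
      -- This frame condition lets invariants mention only the arrays that the body changes.
      (∀ b, b ≠ c → P.Avoids b → t b = s b) →
      Inv i t → Inv (i + 1) ((P.eval t).set c 0 (i + 1))) :
    Inv N ((loop c e P).eval s) := by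
  have : ∀ k ≤ N, Inv k (iter P.eval c s k) ∧ iter P.eval c s k c 0 = k ∧
      ∀ b, b ≠ c → P.Avoids b → iter P.eval c s k b = s b := by
    intro k
    induction k with
    | zero => exact fun _ => ⟨h0, by simp [iter], fun b hb _ => Store.set_of_ne _ hb _ _⟩
    | succ k ih =>
      intro hk
      obtain ⟨i1, i2, i3⟩ := ih (by omega)
      refine ⟨hstep k (by omega) _ i2 i3 i1, by simp [iter], fun b hb hPb => ?_⟩
      simp [iter, Store.set_of_ne _ hb, eval_of_avoids hPb, i3 b hb hPb]
  simpa [eval, hN] using (this N le_rfl).1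

end ForProg

end NashMatching

namespace NashMatching

/-! ## Assignments of workers to bins

Bins `0, …, n - 1` are the firms, bin `n` holds the unmatched workers. -/

open Finset in
/-- Number of workers in bin `x`. -/
def count (m : ℕ) (a : ℕ → ℕ) (x : ℕ) : ℕ := ((range m).filter fun w => a w = x).card

/-- Number of workers in bin `x`, with an offset at bin `n` that makes it larger than all other
bins. -/
def load (m n : ℕ) (a : ℕ → ℕ) (x : ℕ) : ℕ := count m a x + if x = n then m + 2 else 0

/-- Assignments that correspond to matchings along the edges `E`. -/
structure Feasible (m n : ℕ) (E : ℕ → ℕ → Prop) (cap a : ℕ → ℕ) : Prop where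
  le : ∀ w < m, a w ≤ n
  edge : ∀ w < m, a w < n → E w (a w)
  count_le : ∀ g < n, count m a g ≤ cap g

/-- No worker of a bin in `R` has an edge to a firm outside `R`. -/
def ClosedBins (m n : ℕ) (E : ℕ → ℕ → Prop) (a : ℕ → ℕ) (R : Set ℕ) : Prop :=
  ∀ w < m, a w ∈ R → ∀ g < n, E w g → g ∈ R

/-- No firm with free capacity that can be reached from bin `f` is smaller by two. -/
def StableAt (m n : ℕ) (E : ℕ → ℕ → Prop) (cap a : ℕ → ℕ) (f : ℕ) : Prop :=
  ∃ R : Set ℕ, f ∈ R ∧ ClosedBins m n E a R ∧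
    ∀ g ∈ R, g < n → cap g ≤ count m a g ∨ load m n a f ≤ count m a g + 1

theorem count_le_workers (m : ℕ) (a : ℕ → ℕ) (x : ℕ) : count m a x ≤ m := by
  simpa [count] using Finset.card_filter_le (Finset.range m) fun w => a w = x

theorem sum_count (m : ℕ) (a : ℕ → ℕ) (S : Finset ℕ) :
    ∑ x ∈ S, count m a x = ((Finset.range m).filter fun w => a w ∈ S).card := by
  rw [Finset.card_eq_sum_card_fiberwise (f := a) (t := S) (by intro w hw; simpa using (Finset.mem_filter.mp hw).2)]
  refine Finset.sum_congr rfl fun x hx => ?_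
  unfold count
  congr 1
  ext w
  simp only [Finset.mem_filter]
  constructor
  · rintro ⟨h1, rfl⟩; exact ⟨⟨h1, hx⟩, rfl⟩
  · rintro ⟨⟨h1, _⟩, h2⟩; exact ⟨h1, h2⟩

theorem sum_count_range {m n : ℕ} {a : ℕ → ℕ} (h : ∀ w < m, a w < n) :
    ∑ x ∈ Finset.range n, count m a x = m := by
  rw [sum_count, Finset.filter_true_of_mem, Finset.card_range]
  intro w hw
  simpa using h w (by simpa using hw)

/-- Turns a sum of prices weighted by bin sizes into a sum over workers, where two assignments can
be compared worker by worker. -/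
theorem sum_mul_count {m n : ℕ} {a : ℕ → ℕ} (h : ∀ w < m, a w < n) (c : ℕ → ℝ) :
    ∑ x ∈ Finset.range n, (count m a x : ℝ) * c x = ∑ w ∈ Finset.range m, c (a w) := by
  rw [← Finset.sum_fiberwise_of_maps_to (s := Finset.range m) (t := Finset.range n) (g := a)
    (by intro w hw; simpa using h w (by simpa using hw))]
  refine Finset.sum_congr rfl fun x _ => ?_
  rw [Finset.sum_congr rfl (g := fun _ => c x)
    (by intro w hw; rw [(Finset.mem_filter.mp hw).2])]
  simp [count]

open Classical in
-- A worker whose bin lies in a closed set has all its edges into that set, so `b` places it there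
-- as well.
theorem ClosedBins.card_le {m n : ℕ} {E : ℕ → ℕ → Prop} {a b : ℕ → ℕ} {R : Set ℕ}
    (hR : ClosedBins m n E a R) (hb : ∀ w < m, b w < n ∧ E w (b w)) :
    ((Finset.range m).filter fun w => a w ∈ R).card ≤
      ∑ x ∈ (Finset.range n).filter (· ∈ R), count m b x := by
  rw [sum_count]
  refine Finset.card_le_card fun w hw => ?_
  simp only [Finset.mem_filter, Finset.mem_range] at hw ⊢
  exact ⟨hw.1, (hb w hw.1).1, hR w hw.1 hw.2 _ (hb w hw.1).1 (hb w hw.1).2⟩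

/-! ### Optimality of stable assignments -/

section Optimality

variable {m n : ℕ} {E : ℕ → ℕ → Prop} {cap a b : ℕ → ℕ}

open Classical in
-- Hall's argument. The load of bin `n` exceeds every firm's count by at least two, so stability at
-- `n` means that all firms of the certificate `R` are full. An unmatched worker would make the
-- workers in bins of `R` outnumber those seats, although `b` seats all of them in `R`.
theorem Feasible.lt_of_stableAt (ha : Feasible m n E cap a) (hs : StableAt m n E cap a n)
    (hb : ∀ w < m, b w < n ∧ E w (b w)) (hbc : ∀ g < n, count m b g ≤ cap g) :
    ∀ w < m, a w < n := by
  intro w₀ hw₀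
  by_contra hlt
  have hn : a w₀ = n := le_antisymm (ha.le w₀ hw₀) (not_lt.mp hlt)
  obtain ⟨R, hnR, hR, hsat⟩ := hs
  have h1 := hR.card_le hb
  have h2 : ∑ x ∈ (Finset.range n).filter (· ∈ R), count m b x ≤
      ∑ x ∈ (Finset.range n).filter (· ∈ R), count m a x := by
    refine Finset.sum_le_sum fun g hg => ?_
    simp only [Finset.mem_filter, Finset.mem_range] at hg
    have h3 := hbc g hg.1
    have h4 := count_le_workers m a g
    have h5 := hsat g hg.2 hg.1
    simp only [load, if_true] at h5
    omega
  rw [sum_count m a] at h2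
  have h3 : ((Finset.range m).filter fun w => a w ∈ (Finset.range n).filter (· ∈ R)).card <
      ((Finset.range m).filter fun w => a w ∈ R).card := by
    refine Finset.card_lt_card ((Finset.ssubset_iff_of_subset ?_).mpr ⟨w₀, ?_, ?_⟩)
    · intro w hw
      simp only [Finset.mem_filter] at hw ⊢
      exact ⟨hw.1, hw.2.2⟩
    · simp [hw₀, hn, hnR]
    · simp [hn]
  omega

open Classical in
-- Let `U` be the union of the certificates of bins with load at least two. An empty firm lies
-- outside `U`, since it has a free seat. Firms outside `U` hold at most one worker under `a` and at
-- least one under `b`, with strict inequality at the empty firm, while `b` puts into `U` at least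
-- as many workers as `a` does; both totals being `m`, this is impossible.
theorem count_pos_of_stableAt (hs : ∀ f ≤ n, StableAt m n E cap a f) (han : ∀ w < m, a w < n)
    (hb : ∀ w < m, b w < n ∧ E w (b w)) (hbc : ∀ g < n, count m b g ≤ cap g)
    (hb1 : ∀ g < n, 1 ≤ count m b g) : ∀ g < n, 1 ≤ count m a g := by
  intro g₀ hg₀
  by_contra h0
  choose! R hfR hR hsat using hs
  obtain ⟨U, hUmem⟩ : ∃ U : Set ℕ, ∀ x, x ∈ U ↔ ∃ f ≤ n, 2 ≤ load m n a f ∧ x ∈ R f :=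
    ⟨{x | _}, fun _ => Iff.rfl⟩
  have hU : ClosedBins m n E a U := by
    intro w hw hwU g hg he
    obtain ⟨f, hf, h2, hx⟩ := (hUmem _).mp hwU
    exact (hUmem _).mpr ⟨f, hf, h2, hR f hf w hw hx g hg he⟩
  have hg₀U : g₀ ∉ U := by
    rw [hUmem]
    rintro ⟨f, hf, h2, hx⟩
    have h3 := hsat f hf g₀ hx hg₀
    have h4 := hbc g₀ hg₀
    have h5 := hb1 g₀ hg₀
    omega
  have h1 := hU.card_le hb
  have e1 := Finset.sum_filter_add_sum_filter_not (Finset.range n) (· ∈ U) (count m b)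
  have e2 := Finset.sum_filter_add_sum_filter_not (Finset.range n) (· ∈ U) (count m a)
  rw [sum_count_range fun w hw => (hb w hw).1] at e1
  rw [sum_count_range han] at e2
  have h2 : ∑ x ∈ (Finset.range n).filter (· ∈ U), count m a x ≤
      ((Finset.range m).filter fun w => a w ∈ U).card := by
    rw [sum_count]
    refine Finset.card_le_card fun w hw => ?_
    simp only [Finset.mem_filter] at hw ⊢
    exact ⟨hw.1, hw.2.2⟩
  have h3 : ∑ x ∈ (Finset.range n).filter (· ∉ U), count m a x <
      ∑ x ∈ (Finset.range n).filter (· ∉ U), count m b x := by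
    refine Finset.sum_lt_sum (fun g hg => ?_) ⟨g₀, by simp [hg₀, hg₀U], ?_⟩
    · simp only [Finset.mem_filter, Finset.mem_range] at hg
      have h5 := hb1 g hg.1
      have h6 : ¬ 2 ≤ load m n a g := fun h => hg.2 ((hUmem _).mpr ⟨g, hg.1.le, h, hfR g hg.1.le⟩)
      simp only [load, hg.1.ne, if_false] at h6
      omega
    · have h5 := hb1 g₀ hg₀
      omega
  omega

/-- The logarithm at integers lies below its secants. -/
theorem log_sub_log_le {x y l : ℕ} (hx : 1 ≤ x) (hy : 1 ≤ y) (hl : 2 ≤ l)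
    (h1 : x < y → l ≤ x + 1) (h2 : y < x → x ≤ l) :
    Real.log y - Real.log x ≤ ((y : ℝ) - x) * Real.log (l / (l - 1)) := by
  have hx0 : (0 : ℝ) < x := by exact_mod_cast hx
  have hy0 : (0 : ℝ) < y := by exact_mod_cast hy
  have hl1 : (1 : ℝ) < l := by exact_mod_cast hl
  have hl0 : (0 : ℝ) < (l : ℝ) - 1 := by linarith
  rcases lt_trichotomy x y with h | rfl | h
  · obtain ⟨k, rfl⟩ := Nat.exists_eq_add_of_lt h
    have hlx : (l : ℝ) ≤ x + 1 := by exact_mod_cast h1 h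
    have hc : 1 + 1 / (x : ℝ) ≤ l / (l - 1) := by
      rw [show (l : ℝ) / (l - 1) = 1 + 1 / (l - 1) by field_simp; ring]
      gcongr
      linarith
    -- Bernoulli's inequality: with `y = x + (k + 1)`, the ratio `y / x` equals `1 + (k + 1) / x`.
    have hb := one_add_mul_le_pow (a := 1 / (x : ℝ)) (by linarith [one_div_pos.mpr hx0]) (k + 1)
    have h3 : ((x + k + 1 : ℕ) : ℝ) / x ≤ (l / (l - 1)) ^ (k + 1) := by
      calc ((x + k + 1 : ℕ) : ℝ) / x = 1 + (k + 1 : ℕ) * (1 / (x : ℝ)) := by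
            push_cast; field_simp; ring
        _ ≤ (1 + 1 / (x : ℝ)) ^ (k + 1) := hb
        _ ≤ _ := by gcongr
    have h4 := Real.log_le_log (by positivity) h3
    rw [Real.log_div hy0.ne' hx0.ne', Real.log_pow] at h4
    convert h4 using 2
    push_cast; ring
  · simp
  · obtain ⟨k, rfl⟩ := Nat.exists_eq_add_of_lt h
    have hxl : ((y + k + 1 : ℕ) : ℝ) ≤ l := by exact_mod_cast h2 h
    have hx1 : (1 : ℝ) ≤ ((y + k + 1 : ℕ) : ℝ) := by exact_mod_cast hx
    have hy1 : (1 : ℝ) ≤ y := by exact_mod_cast hy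
    have hc : 1 + -(1 / ((y + k + 1 : ℕ) : ℝ)) ≤ ((l : ℝ) / (l - 1))⁻¹ := by
      rw [show ((l : ℝ) / (l - 1))⁻¹ = 1 + -(1 / l) by rw [inv_div]; field_simp; ring]
      gcongr
    have h0 : (0 : ℝ) ≤ 1 + -(1 / ((y + k + 1 : ℕ) : ℝ)) := by
      rw [← sub_eq_add_neg, sub_nonneg, div_le_one hx0]; exact hx1
    -- The mirror image: here `y / x = 1 - (k + 1) / x`, and `1 - 1 / x` is at most `1 - 1 / l`.
    have hb := one_add_mul_le_pow (a := -(1 / ((y + k + 1 : ℕ) : ℝ))) (by linarith) (k + 1)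
    have h3 : (y : ℝ) / ((y + k + 1 : ℕ) : ℝ) ≤ (((l : ℝ) / (l - 1))⁻¹) ^ (k + 1) := by
      calc (y : ℝ) / ((y + k + 1 : ℕ) : ℝ)
            = 1 + (k + 1 : ℕ) * (-(1 / ((y + k + 1 : ℕ) : ℝ))) := by
            rw [div_eq_iff hx0.ne']
            have := mul_one_div_cancel hx0.ne'
            rw [add_mul, mul_assoc, neg_mul, one_div_mul_cancel hx0.ne']
            push_cast; ring
        _ ≤ _ := hb
        _ ≤ _ := by gcongr
    have h4 := Real.log_le_log (by positivity) h3
    rw [Real.log_div hy0.ne' hx0.ne', Real.log_pow, Real.log_inv] at h4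
    refine h4.trans (le_of_eq ?_)
    push_cast; ring

open Classical in
/-- A stable feasible assignment maximizes the product of the firms' numbers of workers. -/
theorem Feasible.prod_count_le (ha : Feasible m n E cap a) (hs : ∀ f ≤ n, StableAt m n E cap a f)
    (hb : ∀ w < m, b w < n ∧ E w (b w)) (hbc : ∀ g < n, count m b g ≤ cap g)
    (hb1 : ∀ g < n, 1 ≤ count m b g) :
    ∏ g ∈ Finset.range n, count m b g ≤ ∏ g ∈ Finset.range n, count m a g := by
  have han := ha.lt_of_stableAt (hs n le_rfl) hb hbc
  have ha1 := count_pos_of_stableAt hs han hb hbc hb1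
  choose! R hfR hR hsat using hs
  -- `c` is the dual price of a firm, decreasing in `l`. The maximum with 2 keeps `l / (l - 1)`
  -- meaningful.
  let l : ℕ → ℕ := fun g => max 2
    (((Finset.range (n + 1)).filter fun f => g ∈ R f).sup (load m n a))
  let c : ℕ → ℝ := fun g => Real.log (l g / (l g - 1))
  have hl2 : ∀ g, 2 ≤ l g := fun g => le_max_left _ _
  have hc : ∀ g h, l g ≤ l h → c h ≤ c g := by
    intro g h hgh
    have h1 : (1 : ℝ) < l g := by exact_mod_cast hl2 g
    have h2 : (l g : ℝ) ≤ l h := by exact_mod_cast hgh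
    refine Real.log_le_log (div_pos (by linarith) (by linarith)) ?_
    rw [div_le_div_iff₀ (by linarith) (by linarith)]
    linarith
  have key : ∑ g ∈ Finset.range n, (Real.log (count m b g) - Real.log (count m a g)) ≤ 0 := by
    calc ∑ g ∈ Finset.range n, (Real.log (count m b g) - Real.log (count m a g))
        ≤ ∑ g ∈ Finset.range n, ((count m b g : ℝ) - count m a g) * c g := by
          refine Finset.sum_le_sum fun g hg => ?_
          have hg' := Finset.mem_range.mp hg
          refine log_sub_log_le (ha1 g hg') (hb1 g hg') (hl2 g) (fun h => ?_) (fun h => ?_)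
          -- A firm that is larger under `b` has a free seat under `a`, so stability bounds the load
          -- of every bin whose certificate contains it.
          · refine max_le (by have := ha1 g hg'; omega) (Finset.sup_le fun f hf => ?_)
            simp only [Finset.mem_filter, Finset.mem_range] at hf
            have h1 := hsat f (by omega) g hf.2 hg'
            have h2 := hbc g hg'
            omega
          · have h1 : load m n a g ≤ l g := le_max_of_le_right
              (Finset.le_sup (f := load m n a) (by simp [hfR g hg'.le]; omega))
            exact le_trans (by simp [load]) h1
      _ = ∑ w ∈ Finset.range m, (c (b w) - c (a w)) := by
          simp only [sub_mul, Finset.sum_sub_distrib, sum_mul_count han,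
            sum_mul_count fun w hw => (hb w hw).1]
      _ ≤ 0 := by
          -- Every certificate containing `a w` contains `b w`, being closed; hence `l` cannot
          -- decrease and the price cannot increase from `a w` to `b w`.
          refine Finset.sum_nonpos fun w hw => sub_nonpos.mpr (hc _ _ ?_)
          have hw' := Finset.mem_range.mp hw
          refine max_le_max le_rfl (Finset.sup_mono fun f hf => ?_)
          simp only [Finset.mem_filter, Finset.mem_range] at hf ⊢
          exact ⟨hf.1, hR f (by omega) w hw' hf.2 _ (hb w hw').1 (hb w hw').2⟩
  have hpos : ∀ d : ℕ → ℕ, (∀ g < n, 1 ≤ count m d g) →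
      ∀ g ∈ Finset.range n, (count m d g : ℝ) ≠ 0 := by
    intro d hd g hg
    have := hd g (Finset.mem_range.mp hg)
    exact_mod_cast (by omega : count m d g ≠ 0)
  rw [Finset.sum_sub_distrib, ← Real.log_prod (hpos b hb1), ← Real.log_prod (hpos a ha1),
    sub_nonpos] at key
  have hP : ∀ d : ℕ → ℕ, (∀ g < n, 1 ≤ count m d g) →
      (0 : ℝ) < ∏ g ∈ Finset.range n, (count m d g : ℝ) := fun d hd =>
    Finset.prod_pos fun g hg => lt_of_le_of_ne (Nat.cast_nonneg _) (hpos d hd g hg).symm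
  exact_mod_cast (Real.log_le_log_iff (hP b hb1) (hP a ha1)).mp key

end Optimality

end NashMatching

namespace NashMatching

/-! ## Labelling the bins reachable from a source bin -/

section Search

variable {m n : ℕ} {E : ℕ → ℕ → Prop} {cap a : ℕ → ℕ} {f : ℕ}

/-- The nonzero values of `d` label `k` bins reachable from bin `f`, and every other labelled bin
has a predecessor with a smaller label. -/
structure Labelled (m n : ℕ) (E : ℕ → ℕ → Prop) (a : ℕ → ℕ) (f : ℕ) (d : ℕ → ℕ) (k : ℕ) :
    Prop where
  source : d f = 1
  le : ∀ y ≤ n, d y ≤ k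
  card : ((Finset.range (n + 1)).filter fun y => d y ≠ 0).card = k
  lt : ∀ y ≤ n, d y ≠ 0 → y ≠ f → y < n
  pred : ∀ y ≤ n, d y ≠ 0 → y ≠ f → ∃ w < m, E w y ∧ d (a w) ≠ 0 ∧ d (a w) < d y

theorem Labelled.init (hf : f ≤ n) {d : ℕ → ℕ} (hd : ∀ y ≤ n, d y = if y = f then 1 else 0) :
    Labelled m n E a f d 1 where
  source := by simp [hd f hf]
  le y hy := by rw [hd y hy]; split_ifs <;> omega
  card := by
    rw [Finset.card_eq_one]
    refine ⟨f, ?_⟩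
    ext y
    simp only [Finset.mem_filter, Finset.mem_range, Finset.mem_singleton]
    constructor
    · rintro ⟨h1, h2⟩
      rw [hd y (by omega)] at h2
      by_contra h; simp [h] at h2
    · rintro rfl
      exact ⟨by omega, by simp [hd y hf]⟩
  lt y hy h1 h2 := by simp [hd y hy, h2] at h1
  pred y hy h1 h2 := by simp [hd y hy, h2] at h1

theorem Labelled.card_le {d : ℕ → ℕ} {k : ℕ} (h : Labelled m n E a f d k) : k ≤ n + 1 := by
  rw [← h.card]
  simpa using Finset.card_filter_le (Finset.range (n + 1)) fun y => d y ≠ 0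

theorem Labelled.update {d : ℕ → ℕ} {k w g : ℕ} (h : Labelled m n E a f d k)
    (ha : ∀ w < m, a w ≤ n) (hw : w < m) (hg : g < n) (hE : E w g) (h1 : d (a w) ≠ 0)
    (h2 : d g = 0) : Labelled m n E a f (Function.update d g (k + 1)) (k + 1) := by
  have hne : ∀ y, d y ≠ 0 → y ≠ g := by rintro y hy rfl; exact hy h2
  have hfg : f ≠ g := hne f (by simp [h.source])
  refine ⟨?_, fun y hy => ?_, ?_, fun y hy h3 h4 => ?_, fun y hy h3 h4 => ?_⟩
  · rw [Function.update_of_ne hfg, h.source]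
  · rcases eq_or_ne y g with rfl | hyg
    · simp
    · rw [Function.update_of_ne hyg]; exact (h.le y hy).trans (Nat.le_succ k)
  · have : ((Finset.range (n + 1)).filter fun y => Function.update d g (k + 1) y ≠ 0) =
        insert g ((Finset.range (n + 1)).filter fun y => d y ≠ 0) := by
      ext y
      rcases eq_or_ne y g with rfl | hyg
      · simp; omega
      · simp [hyg]
    rw [this, Finset.card_insert_of_notMem (by simp [h2]), h.card]
  · rcases eq_or_ne y g with rfl | hyg
    · exact hg
    · rw [Function.update_of_ne hyg] at h3; exact h.lt y hy h3 h4
  · rcases eq_or_ne y g with rfl | hyg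
    · refine ⟨w, hw, hE, ?_⟩
      rw [Function.update_of_ne (hne _ h1), Function.update_self]
      exact ⟨h1, Nat.lt_succ_of_le (h.le _ (ha w hw))⟩
    · rw [Function.update_of_ne hyg] at h3 ⊢
      obtain ⟨w', hw', e1, e2, e3⟩ := h.pred y hy h3 h4
      exact ⟨w', hw', e1, by rwa [Function.update_of_ne (hne _ e2)],
        by rwa [Function.update_of_ne (hne _ e2)]⟩

/-- Predecessors have smaller labels, so induction on the label works. Thus a labelled improving
target lies in every possible certificate, which refutes stability. -/
theorem Labelled.mem_of_closedBins {d : ℕ → ℕ} {k : ℕ} (h : Labelled m n E a f d k)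
    (ha : ∀ w < m, a w ≤ n) {R : Set ℕ} (hf : f ∈ R) (hR : ClosedBins m n E a R) :
    ∀ l, ∀ y ≤ n, d y = l → d y ≠ 0 → y ∈ R := by
  intro l
  induction l using Nat.strong_induction_on with
  | _ l ih =>
    rintro y hy rfl h0
    rcases eq_or_ne y f with rfl | hyf
    · exact hf
    · obtain ⟨w, hw, e1, e2, e3⟩ := h.pred y hy h0 hyf
      exact hR w hw (ih _ e3 (a w) (ha w hw) rfl e2) y (h.lt y hy h0 hyf) e1

/-- The edges scanned before `(w, g)` do not lead from labelled to unlabelled bins. -/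
def ClosedUpTo (n : ℕ) (E : ℕ → ℕ → Prop) (a d : ℕ → ℕ) (w g : ℕ) : Prop :=
  ∀ w' g', g' < n → (w' < w ∨ w' = w ∧ g' < g) → d (a w') ≠ 0 → E w' g' → d g' ≠ 0

theorem ClosedUpTo.row {d : ℕ → ℕ} {w : ℕ} (h : ClosedUpTo n E a d w n) :
    ClosedUpTo n E a d (w + 1) 0 :=
  fun w' g' hg' h1 => h w' g' hg' (by omega)

/-- Loop invariant of the labelling: before the edge `(w, g)` in round `r`, either no edge leads
out of the labelled bins or every round has labelled a bin. -/
def SearchInv (m n : ℕ) (E : ℕ → ℕ → Prop) (a : ℕ → ℕ) (f r w g : ℕ) (d : ℕ → ℕ) (k : ℕ) :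
    Prop :=
  Labelled m n E a f d k ∧
    (ClosedUpTo n E a d m 0 ∨ r + 1 ≤ k ∧ (r + 2 ≤ k ∨ ClosedUpTo n E a d w g))

theorem SearchInv.step_update {d : ℕ → ℕ} {k r w g : ℕ} (h : SearchInv m n E a f r w g d k)
    (ha : ∀ w < m, a w ≤ n) (hw : w < m) (hg : g < n) (hE : E w g) (h1 : d (a w) ≠ 0)
    (h2 : d g = 0) :
    SearchInv m n E a f r w (g + 1) (Function.update d g (k + 1)) (k + 1) := by
  refine ⟨h.1.update ha hw hg hE h1 h2, ?_⟩
  rcases h.2 with hc | ⟨hk, _⟩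
  · exact absurd h2 (hc w g hg (Or.inl hw) h1 hE)
  · exact Or.inr ⟨by omega, Or.inl (by omega)⟩

theorem SearchInv.step_skip {d : ℕ → ℕ} {k r w g : ℕ} (h : SearchInv m n E a f r w g d k)
    (hs : d (a w) ≠ 0 → E w g → d g ≠ 0) : SearchInv m n E a f r w (g + 1) d k := by
  refine ⟨h.1, h.2.imp id fun ⟨hk, h3⟩ => ⟨hk, h3.imp id fun hc => ?_⟩⟩
  intro w' g' hg' h4 h5 h6
  by_cases h7 : w' = w ∧ g' = g
  · obtain ⟨rfl, rfl⟩ := h7; exact hs h5 h6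
  · exact hc w' g' hg' (by omega) h5 h6

theorem SearchInv.row {d : ℕ → ℕ} {k r w : ℕ} (h : SearchInv m n E a f r w n d k) :
    SearchInv m n E a f r (w + 1) 0 d k :=
  ⟨h.1, h.2.imp id fun h3 => ⟨h3.1, h3.2.imp id ClosedUpTo.row⟩⟩

theorem SearchInv.round {d : ℕ → ℕ} {k r : ℕ} (h : SearchInv m n E a f r m 0 d k) :
    SearchInv m n E a f (r + 1) 0 0 d k := by
  refine ⟨h.1, ?_⟩
  rcases h.2 with hc | ⟨hk, h3 | hc⟩
  · exact Or.inl hc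
  · exact Or.inr ⟨h3, Or.inr fun w' g' _ h4 => by omega⟩
  · exact Or.inl hc

/-- Pigeonhole: `n + 1` rounds that each label a new bin would yield `n + 2` labelled bins among `n
+ 1`. -/
theorem SearchInv.closed {d : ℕ → ℕ} {k : ℕ} (h : SearchInv m n E a f (n + 1) 0 0 d k) :
    ClosedBins m n E a {y | d y ≠ 0} := by
  rcases h.2 with hc | ⟨hk, _⟩
  · exact fun w hw h1 g hg hE => hc w g hg (Or.inl hw) h1 hE
  · have := h.1.card_le
    omega

end Search

/-! ## Moving workers along a labelled path -/

section Walk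

variable {m n : ℕ} {E : ℕ → ℕ → Prop} {cap a₀ a d : ℕ → ℕ} {f k T c : ℕ}

theorem count_update {w : ℕ} (hw : w < m) (a : ℕ → ℕ) (c y : ℕ) :
    count m (Function.update a w c) y + (if y = a w then 1 else 0) =
      count m a y + if y = c then 1 else 0 := by
  have hw' := Finset.mem_range.mpr hw
  simp only [count, Finset.card_filter]
  rw [← Finset.add_sum_erase _ _ hw', ← Finset.add_sum_erase (Finset.range m) _ hw']
  have : ∀ i ∈ (Finset.range m).erase w, (if Function.update a w c i = y then 1 else 0) =
      if a i = y then 1 else 0 := by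
    intro i hi
    rw [Function.update_of_ne (Finset.ne_of_mem_erase hi)]
  rw [Finset.sum_congr rfl this]
  simp only [Function.update_self, eq_comm (a := y)]
  omega

/-- Worker `w` can be moved to bin `c` from a bin with a smaller label. -/
def Movable (E : ℕ → ℕ → Prop) (d a : ℕ → ℕ) (c w : ℕ) : Prop :=
  d (a w) < d c ∧ d (a w) ≠ 0 ∧ E w c

/-- The assignment `a` arises from `a₀` by moving workers along a path from bin `c` to `T`. -/
structure PathMoved (m n : ℕ) (E : ℕ → ℕ → Prop) (d a₀ : ℕ → ℕ) (f T : ℕ) (a : ℕ → ℕ) (c : ℕ) :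
    Prop where
  ne_zero : d c ≠ 0
  le : c ≤ n
  agree : ∀ w < m, a w = a₀ w ∨ d c ≤ d (a₀ w)
  bin_le : ∀ w < m, a w ≤ n
  edge : ∀ w < m, a w < n → E w (a w)
  count_eq : ∀ y, count m a y + (if y = c then 1 else 0) = count m a₀ y + if y = T then 1 else 0
  -- Needed so that a failed search, whose target is the source itself, preserves the assignment and
  -- not merely its counts.
  trivial : T = f → a = a₀ ∧ c = f

theorem Labelled.not_movable (hd : Labelled m n E a₀ f d k) (w : ℕ) : ¬ Movable E d a f w := by
  rintro ⟨h1, h2, _⟩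
  rw [hd.source] at h1
  omega

/-- The labelling refers to the original assignment `a₀`. The worker it provides comes from a bin
with smaller label than `c`, and by `agree` such workers have not been moved yet. -/
theorem PathMoved.exists_movable (hd : Labelled m n E a₀ f d k) (h : PathMoved m n E d a₀ f T a c)
    (hc : c ≠ f) : ∃ w < m, Movable E d a c w := by
  obtain ⟨w, hw, e1, e2, e3⟩ := hd.pred c h.le h.ne_zero hc
  have : a w = a₀ w := (h.agree w hw).resolve_right (by omega)
  exact ⟨w, hw, by rwa [this], by rwa [this], e1⟩

theorem PathMoved.move (hd : Labelled m n E a₀ f d k) (h : PathMoved m n E d a₀ f T a c)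
    {w : ℕ} (hw : w < m) (hm : Movable E d a c w) :
    PathMoved m n E d a₀ f T (Function.update a w c) (a w) := by
  have hcf : c ≠ f := by rintro rfl; exact hd.not_movable w hm
  obtain ⟨m1, m2, m3⟩ := hm
  refine ⟨m2, h.bin_le w hw, fun v hv => ?_, fun v hv => ?_, fun v hv hlt => ?_, fun y => ?_,
    fun hT => absurd (h.trivial hT).2 hcf⟩
  · rcases eq_or_ne v w with rfl | hvw
    · exact Or.inr ((h.agree v hv).elim (fun h1 => by rw [h1]) fun h1 => m1.le.trans h1)
    · rw [Function.update_of_ne hvw]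
      exact (h.agree v hv).imp id fun h1 => m1.le.trans h1
  · rcases eq_or_ne v w with rfl | hvw
    · simpa using h.le
    · rw [Function.update_of_ne hvw]; exact h.bin_le v hv
  · rcases eq_or_ne v w with rfl | hvw
    · simpa using m3
    · rw [Function.update_of_ne hvw] at hlt ⊢; exact h.edge v hv hlt
  · have h1 := count_update hw a c y
    have h2 := h.count_eq y
    omega

/-- Loop invariant of the walk: before worker `w` in round `r`, either the source is reached or the
label of the current bin has decreased in every round. -/
def WalkInv (m n : ℕ) (E : ℕ → ℕ → Prop) (d a₀ : ℕ → ℕ) (f T r w : ℕ) (a : ℕ → ℕ) (c : ℕ) : Prop :=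
  PathMoved m n E d a₀ f T a c ∧
    (c = f ∨ d c + r ≤ n + 1 ∧ (d c + r + 1 ≤ n + 1 ∨ ∀ v < w, ¬ Movable E d a c v))

theorem WalkInv.step_move (hd : Labelled m n E a₀ f d k) {r w : ℕ}
    (h : WalkInv m n E d a₀ f T r w a c) (hw : w < m) (hm : Movable E d a c w) :
    WalkInv m n E d a₀ f T r (w + 1) (Function.update a w c) (a w) := by
  refine ⟨h.1.move hd hw hm, Or.inr ?_⟩
  rcases h.2 with rfl | h2
  · exact absurd hm (hd.not_movable w)
  · have := hm.1
    omega

theorem WalkInv.step_skip {r w : ℕ} (h : WalkInv m n E d a₀ f T r w a c)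
    (hm : ¬ Movable E d a c w) : WalkInv m n E d a₀ f T r (w + 1) a c := by
  refine ⟨h.1, h.2.imp id fun h2 => ⟨h2.1, h2.2.imp id fun h3 v hv => ?_⟩⟩
  rcases Nat.lt_succ_iff_lt_or_eq.mp hv with hv | rfl
  · exact h3 v hv
  · exact hm

theorem WalkInv.round (hd : Labelled m n E a₀ f d k) {r : ℕ}
    (h : WalkInv m n E d a₀ f T r m a c) : WalkInv m n E d a₀ f T (r + 1) 0 a c := by
  refine ⟨h.1, ?_⟩
  by_cases hc : c = f
  · exact Or.inl hc
  · obtain ⟨_, h2 | h2⟩ := h.2.resolve_left hc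
    · exact Or.inr ⟨by omega, Or.inr fun v hv => by omega⟩
    · obtain ⟨v, hv, hm⟩ := h.1.exists_movable hd hc
      exact absurd hm (h2 v hv)

/-- Labels are positive and at most `n + 1`, so a label that falls in each of `n + 1` rounds is
impossible; the walk has reached the source, where no worker is movable and further rounds are idle.
-/
theorem WalkInv.end (h : WalkInv m n E d a₀ f T (n + 1) 0 a c) : PathMoved m n E d a₀ f T a f := by
  rcases h.2 with rfl | ⟨h2, _⟩
  · exact h.1
  · exact absurd (by omega) h.1.ne_zero

theorem Feasible.pathMoved_init (h : Feasible m n E cap a₀) (hd : Labelled m n E a₀ f d k)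
    (hT : T ≤ n) (hdT : d T ≠ 0) : WalkInv m n E d a₀ f T 0 0 a₀ T :=
  ⟨⟨hdT, hT, fun _ _ => Or.inl rfl, h.le, h.edge, fun _ => rfl, fun h1 => ⟨rfl, h1⟩⟩,
    Or.inr ⟨(hd.le T hT).trans hd.card_le, Or.inr fun _ hv => absurd hv (Nat.not_lt_zero _)⟩⟩

/-- The sum of the squared loads. -/
def potential (m n : ℕ) (a : ℕ → ℕ) : ℕ := ∑ y ∈ Finset.range (n + 1), load m n a y ^ 2

theorem PathMoved.load_eq (h : PathMoved m n E d a₀ f T a f) (y : ℕ) :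
    load m n a y + (if y = f then 1 else 0) = load m n a₀ y + if y = T then 1 else 0 := by
  have := h.count_eq y
  simp only [load]
  omega

/-- Only the two ends of the path change. If their loads are `q + 2 + p` and `q`, the sum of squares
drops by `2p + 2`. -/
theorem PathMoved.potential_lt (h : PathMoved m n E d a₀ f T a f) (hf : f ≤ n) (hT : T ≤ n)
    (hl : load m n a₀ T + 2 ≤ load m n a₀ f) : potential m n a < potential m n a₀ := by
  have hTf : T ≠ f := by rintro rfl; omega
  have hfm : f ∈ Finset.range (n + 1) := by simp; omega
  have hTm : T ∈ (Finset.range (n + 1)).erase f := by simp [hTf]; omega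
  unfold potential
  rw [← Finset.add_sum_erase _ _ hfm, ← Finset.add_sum_erase _ _ hTm,
    ← Finset.add_sum_erase (Finset.range (n + 1)) _ hfm, ← Finset.add_sum_erase _ _ hTm]
  have hrest : ∀ y ∈ ((Finset.range (n + 1)).erase f).erase T,
      load m n a y ^ 2 = load m n a₀ y ^ 2 := by
    intro y hy
    have h1 := h.load_eq y
    simp only [Finset.mem_erase] at hy
    simp only [hy.1, hy.2.1, if_false] at h1
    rw [show load m n a y = load m n a₀ y by omega]
  rw [Finset.sum_congr rfl hrest]
  have h1 := h.load_eq f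
  have h2 := h.load_eq T
  simp only [hTf, hTf.symm, if_true, if_false] at h1 h2
  obtain ⟨p, hp⟩ := Nat.exists_eq_add_of_le hl
  rw [show load m n a f = load m n a₀ T + 1 + p by omega,
    show load m n a T = load m n a₀ T + 1 by omega, hp]
  nlinarith

theorem PathMoved.feasible (h : PathMoved m n E d a₀ f T a f) (ha : Feasible m n E cap a₀)
    (hT : T = f ∨ count m a₀ T < cap T) : Feasible m n E cap a := by
  refine ⟨h.bin_le, h.edge, fun g hg => ?_⟩
  have h1 := h.count_eq g
  have h2 := ha.count_le g hg
  rcases hT with rfl | hT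
  · omega
  · by_cases hgT : g = T
    · subst hgT; simp only [if_true] at h1; omega
    · simp only [hgT, if_false] at h1; omega

end Walk

end NashMatching

namespace NashMatching

/-! ## The program

Array `0` is the input, array `1` the output, `2` the positions of the rows of the workers'
valuations, `3` the assignment, `4` the loads and `5` the labels of the bins. The scalars are `6`
(position in the input), `7` (number of labels), `8` (target bin), `9` (current bin), `18`
(previous bin); arrays `10` to `17` are loop counters, `13` being the source bin. -/

namespace Expr

/-- Cell `0` of an array. -/
@[simp] abbrev var (a : ℕ) : Expr := .read a (.const 0)

/-- Number of workers. -/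
@[simp] abbrev workers : Expr := .read 0 (.const 0)

/-- Number of firms. -/
@[simp] abbrev firms : Expr := .read 0 (.const 1)

end Expr

/-- Pairs with nonzero value of the worker, read from the input. -/
def InputEdge (x : ℕ → ℕ) (w g : ℕ) : Prop := x (2 + x 1 + w * x 1 + g) ≠ 0

/-- Capacities, read from the input. -/
def inputCap (x : ℕ → ℕ) (g : ℕ) : ℕ := x (2 + g)

/-- The input `x` and the table of row positions are in memory. -/
structure HasTables (x : ℕ → ℕ) (s : Store) : Prop where
  input : s 0 = x
  row : ∀ w < x 0, s 2 w = 2 + x 1 + w * x 1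

theorem HasTables.congr {x : ℕ → ℕ} {s t : Store} (h : HasTables x s) (h0 : t 0 = s 0)
    (h2 : t 2 = s 2) : HasTables x t :=
  ⟨h0.trans h.input, fun w hw => by rw [h2, h.row w hw]⟩

theorem HasTables.edge_iff {x : ℕ → ℕ} {s : Store} (h : HasTables x s) {w : ℕ} (hw : w < x 0)
    (g : ℕ) : s 0 (s 2 w + g) ≠ 0 ↔ InputEdge x w g := by
  rw [h.input, h.row w hw]; rfl

namespace ForProg

/-- Label the target of an edge whose source is labelled. -/
def labelEdge : ForProg :=
  .ite (.read 5 (.read 3 (.var 16)))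
    (.ite (.read 0 (.add (.read 2 (.var 16)) (.var 17)))
      (.ite (.read 5 (.var 17)) .skip
        (.seq (.write 7 (.const 0) (.add (.var 7) (.const 1))) (.write 5 (.var 17) (.var 7))))
      .skip)
    .skip

/-- Scan all edges of a worker. -/
def labelRow : ForProg := .loop 17 .firms labelEdge

/-- Scan all edges. -/
def labelRound : ForProg := .loop 16 .workers labelRow

/-- Label the bins reachable from the source bin. -/
def search : ForProg :=
  .seq (.loop 14 (.add .firms (.const 1)) (.write 5 (.var 14) (.const 0)))
    (.seq (.write 5 (.var 13) (.const 1))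
      (.seq (.write 7 (.const 0) (.const 1))
        (.loop 15 (.add .firms (.const 1)) labelRound)))

theorem labelEdge_spec {x : ℕ → ℕ} {f r w g : ℕ} {t : Store} (ht : HasTables x t)
    (ha : ∀ w < x 0, t 3 w ≤ x 1) (hw : w < x 0) (hg : g < x 1) (h16 : t 16 0 = w)
    (h17 : t 17 0 = g) (h : SearchInv (x 0) (x 1) (InputEdge x) (t 3) f r w g (t 5) (t 7 0)) :
    SearchInv (x 0) (x 1) (InputEdge x) (t 3) f r w (g + 1)
      (labelEdge.eval t 5) (labelEdge.eval t 7 0) := by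
  subst h16 h17
  have hE := ht.edge_iff hw (t 17 0)
  simp only [labelEdge, eval]
  split_ifs with h1 h2 h3 <;> simp only [Expr.val] at *
  · exact h.step_skip fun _ _ => h3
  · simpa using h.step_update ha hw hg (hE.mp h2) h1 (not_not.mp h3)
  · exact h.step_skip fun _ h4 => absurd (hE.mpr h4) h2
  · exact h.step_skip fun h4 => absurd h4 h1

theorem labelRow_spec {x : ℕ → ℕ} {f r w : ℕ} {t : Store} (ht : HasTables x t)
    (ha : ∀ w < x 0, t 3 w ≤ x 1) (hw : w < x 0) (h16 : t 16 0 = w)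
    (h : SearchInv (x 0) (x 1) (InputEdge x) (t 3) f r w 0 (t 5) (t 7 0)) :
    SearchInv (x 0) (x 1) (InputEdge x) (t 3) f r (w + 1) 0
      (labelRow.eval t 5) (labelRow.eval t 7 0) := by
  refine SearchInv.row (loop_induction (s := t) (x 1) (by simp [Expr.val, ht.input])
    (fun g u => SearchInv (x 0) (x 1) (InputEdge x) (t 3) f r w g (u 5) (u 7 0))
    (by simpa using h) fun g hg u hc hu hinv => ?_)
  have e0 := hu 0 (by decide) (by simp [labelEdge, Avoids])
  have e2 := hu 2 (by decide) (by simp [labelEdge, Avoids])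
  have e3 := hu 3 (by decide) (by simp [labelEdge, Avoids])
  have e16 := hu 16 (by decide) (by simp [labelEdge, Avoids])
  have := labelEdge_spec (f := f) (r := r) (ht.congr e0 e2) (by rwa [e3]) hw hg
    (by rw [e16, h16]) hc (by rwa [e3])
  rw [e3] at this
  simpa using this

theorem labelRound_spec {x : ℕ → ℕ} {f r : ℕ} {t : Store} (ht : HasTables x t)
    (ha : ∀ w < x 0, t 3 w ≤ x 1)
    (h : SearchInv (x 0) (x 1) (InputEdge x) (t 3) f r 0 0 (t 5) (t 7 0)) :
    SearchInv (x 0) (x 1) (InputEdge x) (t 3) f (r + 1) 0 0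
      (labelRound.eval t 5) (labelRound.eval t 7 0) := by
  refine SearchInv.round (loop_induction (s := t) (x 0) (by simp [Expr.val, ht.input])
    (fun w u => SearchInv (x 0) (x 1) (InputEdge x) (t 3) f r w 0 (u 5) (u 7 0))
    (by simpa using h) fun w hw u hc hu hinv => ?_)
  have e0 := hu 0 (by decide) (by simp [labelRow, labelEdge, Avoids])
  have e2 := hu 2 (by decide) (by simp [labelRow, labelEdge, Avoids])
  have e3 := hu 3 (by decide) (by simp [labelRow, labelEdge, Avoids])
  have := labelRow_spec (f := f) (r := r) (ht.congr e0 e2) (by rwa [e3]) hw hc (by rwa [e3])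
  rw [e3] at this
  simpa using this

theorem search_spec {x : ℕ → ℕ} {f : ℕ} {s : Store} (hs : HasTables x s)
    (ha : ∀ w < x 0, s 3 w ≤ x 1) (hf : f ≤ x 1) (h13 : s 13 0 = f) :
    ∃ k, Labelled (x 0) (x 1) (InputEdge x) (s 3) f (search.eval s 5) k ∧
      ClosedBins (x 0) (x 1) (InputEdge x) (s 3) {y | search.eval s 5 y ≠ 0} := by
  let clear : ForProg := .loop 14 (.add .firms (.const 1)) (.write 5 (.var 14) (.const 0))
  have hclear : ∀ y < x 1 + 1, clear.eval s 5 y = 0 := by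
    refine loop_induction (s := s) (x 1 + 1) (by simp [Expr.val, hs.input])
      (fun k u => ∀ y < k, u 5 y = 0) (by simp) fun k _ u hc _ hinv y hy => ?_
    rcases Nat.lt_succ_iff_lt_or_eq.mp hy with hy | rfl
    · simp [eval, Expr.val, hc, hy.ne, hinv y hy]
    · simp [eval, Expr.val, hc]
  have hav : ∀ b, b ≠ 14 → b ≠ 5 → clear.eval s b = s b := fun b h1 h2 =>
    eval_of_avoids (by simp [clear, Avoids, h1, h2]) s
  let u : Store := ((clear.eval s).set 5 f 1).set 7 0 1
  have hu : search.eval s = (loop 15 (.add .firms (.const 1)) labelRound).eval u := by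
    have h : search.eval s = (loop 15 (.add .firms (.const 1)) labelRound).eval
        (((clear.eval s).set 5 (clear.eval s 13 0) 1).set 7 0 1) := rfl
    rw [h, hav 13 (by decide) (by decide), h13]
  have e0 : u 0 = s 0 := by simp [u, hav]
  have e2 : u 2 = s 2 := by simp [u, hav]
  have e3 : u 3 = s 3 := by simp [u, hav]
  have h5 : ∀ y ≤ x 1, u 5 y = if y = f then 1 else 0 := by
    intro y hy
    simp [u, Function.update_apply, hclear y (by omega)]
  have main := loop_induction (c := 15) (P := labelRound) (s := u) (x 1 + 1)
    (e := .add .firms (.const 1)) (by simp [Expr.val, e0, hs.input])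
    (fun r v => SearchInv (x 0) (x 1) (InputEdge x) (s 3) f r 0 0 (v 5) (v 7 0))
    (by
      refine ⟨by simpa [u] using Labelled.init hf h5, Or.inr ⟨by simp [u], Or.inr ?_⟩⟩
      exact fun w' g' _ h4 => by omega)
    (by
      intro r _ v hc hv hinv
      have v0 := hv 0 (by decide) (by simp [labelRound, labelRow, labelEdge, Avoids])
      have v2 := hv 2 (by decide) (by simp [labelRound, labelRow, labelEdge, Avoids])
      have v3 := hv 3 (by decide) (by simp [labelRound, labelRow, labelEdge, Avoids])
      have := labelRound_spec (f := f) (r := r) (hs.congr (v0.trans e0) (v2.trans e2))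
        (by rwa [v3, e3]) (by rwa [v3, e3])
      rw [v3, e3] at this
      simpa using this)
  rw [hu]
  exact ⟨_, main.1, main.closed⟩

/-- Choose a labelled bin with free capacity that is smaller than the source bin by two; if there is
none, choose the source bin. -/
def chooseTarget : ForProg :=
  .seq (.write 8 (.const 0) (.var 13))
    (.loop 17 .firms
      (.ite (.read 5 (.var 17))
        -- Truncated differences serve as strict comparisons: this one tests for a free seat, the
        -- next for a load gap of at least two.
        (.ite (.sub (.read 0 (.add (.const 2) (.var 17))) (.read 4 (.var 17)))
          (.ite (.sub (.read 4 (.var 13)) (.add (.read 4 (.var 17)) (.const 1)))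
            (.write 8 (.const 0) (.var 17)) .skip)
          .skip)
        .skip))

theorem chooseTarget_spec {x : ℕ → ℕ} {f : ℕ} {s : Store} (hs : s 0 = x) (h13 : s 13 0 = f) :
    (chooseTarget.eval s 8 0 = f ∧
      ∀ g < x 1, s 5 g ≠ 0 → inputCap x g ≤ s 4 g ∨ s 4 f ≤ s 4 g + 1) ∨
    ∃ g < x 1, chooseTarget.eval s 8 0 = g ∧ s 5 g ≠ 0 ∧ s 4 g < inputCap x g ∧
      s 4 g + 2 ≤ s 4 f := by
  simp only [chooseTarget, eval.eq_3]
  refine loop_induction (x 1) (by simp [eval, Expr.val, hs])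
    (fun i u => (u 8 0 = f ∧
      ∀ g < i, s 5 g ≠ 0 → inputCap x g ≤ s 4 g ∨ s 4 f ≤ s 4 g + 1) ∨
      ∃ g < x 1, u 8 0 = g ∧ s 5 g ≠ 0 ∧ s 4 g < inputCap x g ∧ s 4 g + 2 ≤ s 4 f)
    (by simp [eval, Expr.val, h13]) fun i hi u hc hu hinv => ?_
  have e0 : u 0 = x := by rw [hu 0 (by decide) (by simp [Avoids])]; simpa [eval] using hs
  have e4 : u 4 = s 4 := by rw [hu 4 (by decide) (by simp [Avoids])]; simp [eval]
  have e5 : u 5 = s 5 := by rw [hu 5 (by decide) (by simp [Avoids])]; simp [eval]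
  have e13 : u 13 0 = f := by rw [hu 13 (by decide) (by simp [Avoids])]; simpa [eval] using h13
  have hskip : (s 5 i ≠ 0 → inputCap x i ≤ s 4 i ∨ s 4 f ≤ s 4 i + 1) →
      (u 8 0 = f ∧ ∀ g < i + 1, s 5 g ≠ 0 → inputCap x g ≤ s 4 g ∨ s 4 f ≤ s 4 g + 1) ∨
      ∃ g < x 1, u 8 0 = g ∧ s 5 g ≠ 0 ∧ s 4 g < inputCap x g ∧ s 4 g + 2 ≤ s 4 f := by
    refine fun h => hinv.imp (fun h1 => ⟨h1.1, fun g hg => ?_⟩) id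
    rcases Nat.lt_succ_iff_lt_or_eq.mp hg with hg | rfl
    · exact h1.2 g hg
    · exact h
  simp only [eval, Expr.val, e0, e4, e5, e13, hc]
  have hcap : inputCap x i = x (2 + i) := rfl
  split_ifs with h1 h2 h3
  · simp only [Store.set_of_ne _ (show (8 : ℕ) ≠ 17 by decide), Store.set_self,
      Function.update_self]
    exact Or.inr ⟨i, hi, rfl, h1, by omega, by omega⟩
  · simpa using hskip fun _ => by omega
  · simpa using hskip fun _ => by omega
  · simpa using hskip fun h => absurd h h1

/-- Move a worker to the current bin from a bin with a smaller label. -/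
def moveWorker : ForProg :=
  .ite (.sub (.read 5 (.var 9)) (.read 5 (.read 3 (.var 16))))
    (.ite (.read 5 (.read 3 (.var 16)))
      (.ite (.read 0 (.add (.read 2 (.var 16)) (.var 9)))
        (.seq (.write 18 (.const 0) (.read 3 (.var 16)))
          (.seq (.write 3 (.var 16) (.var 9)) (.write 9 (.const 0) (.var 18))))
        .skip)
      .skip)
    .skip

/-- Try to move each worker. -/
def walkRound : ForProg := .loop 16 .workers moveWorker

/-- Move workers along a path from the source bin to the target bin. -/
def walk : ForProg :=
  .seq (.write 9 (.const 0) (.var 8)) (.loop 15 (.add .firms (.const 1)) walkRound)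

theorem moveWorker_spec {x a₀ : ℕ → ℕ} {f k T r w : ℕ} {t : Store} (ht : HasTables x t)
    (hd : Labelled (x 0) (x 1) (InputEdge x) a₀ f (t 5) k) (hw : w < x 0) (h16 : t 16 0 = w)
    (h : WalkInv (x 0) (x 1) (InputEdge x) (t 5) a₀ f T r w (t 3) (t 9 0)) :
    WalkInv (x 0) (x 1) (InputEdge x) (t 5) a₀ f T r (w + 1)
      (moveWorker.eval t 3) (moveWorker.eval t 9 0) := by
  subst h16
  have hE := ht.edge_iff hw (t 9 0)
  simp only [moveWorker, eval]
  split_ifs with h1 h2 h3 <;> simp only [Expr.val] at *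
  · simpa using h.step_move hd hw ⟨by omega, h2, hE.mp h3⟩
  · exact h.step_skip fun hm => h3 (hE.mpr hm.2.2)
  · exact h.step_skip fun hm => h2 hm.2.1
  · exact h.step_skip fun hm => h1 (by have := hm.1; omega)

theorem walkRound_spec {x a₀ : ℕ → ℕ} {f k T r : ℕ} {t : Store} (ht : HasTables x t)
    (hd : Labelled (x 0) (x 1) (InputEdge x) a₀ f (t 5) k)
    (h : WalkInv (x 0) (x 1) (InputEdge x) (t 5) a₀ f T r 0 (t 3) (t 9 0)) :
    WalkInv (x 0) (x 1) (InputEdge x) (t 5) a₀ f T (r + 1) 0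
      (walkRound.eval t 3) (walkRound.eval t 9 0) := by
  refine WalkInv.round hd (loop_induction (s := t) (x 0) (by simp [Expr.val, ht.input])
    (fun w u => WalkInv (x 0) (x 1) (InputEdge x) (t 5) a₀ f T r w (u 3) (u 9 0))
    (by simpa using h) fun w hw u hc hu hinv => ?_)
  have e0 := hu 0 (by decide) (by simp [moveWorker, Avoids])
  have e2 := hu 2 (by decide) (by simp [moveWorker, Avoids])
  have e5 := hu 5 (by decide) (by simp [moveWorker, Avoids])
  have := moveWorker_spec (T := T) (r := r) (ht.congr e0 e2) (by rwa [e5]) hw hc (by rwa [e5])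
  rw [e5] at this
  simpa using this

theorem walk_spec {x : ℕ → ℕ} {f k T : ℕ} {s : Store} (hs : HasTables x s)
    (ha : Feasible (x 0) (x 1) (InputEdge x) (inputCap x) (s 3))
    (hd : Labelled (x 0) (x 1) (InputEdge x) (s 3) f (s 5) k) (h8 : s 8 0 = T) (hT : T ≤ x 1)
    (hdT : s 5 T ≠ 0) :
    PathMoved (x 0) (x 1) (InputEdge x) (s 5) (s 3) f T (walk.eval s 3) f := by
  let u : Store := s.set 9 0 T
  have hu : walk.eval s = (loop 15 (.add .firms (.const 1)) walkRound).eval u := by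
    simp only [walk, eval, Expr.val, u, h8]
  have main := loop_induction (c := 15) (P := walkRound) (s := u) (x 1 + 1)
    (e := .add .firms (.const 1)) (by simp [Expr.val, u, hs.input])
    (fun r v => WalkInv (x 0) (x 1) (InputEdge x) (s 5) (s 3) f T r 0 (v 3) (v 9 0))
    (by simpa [u] using ha.pathMoved_init hd hT hdT)
    (by
      intro r _ v hc hv hinv
      have v0 := hv 0 (by decide) (by simp [walkRound, moveWorker, Avoids])
      have v2 := hv 2 (by decide) (by simp [walkRound, moveWorker, Avoids])
      have v5 : v 5 = s 5 := by
        rw [hv 5 (by decide) (by simp [walkRound, moveWorker, Avoids])]; simp [u]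
      have := walkRound_spec (T := T) (r := r)
        (hs.congr (v0.trans (by simp [u])) (v2.trans (by simp [u])))
        (by rwa [v5]) (by rwa [v5])
      rw [v5] at this
      simpa using this)
  rw [hu]
  exact main.end

end ForProg

end NashMatching

/-! ### Correctness and termination of the local search -/

namespace NashMatching

/-- Memory between two searches: the tables, an empty output and a feasible assignment with its
loads. -/
structure Ready (x : ℕ → ℕ) (s : Store) : Prop where
  tables : HasTables x s
  output : s 1 = fun _ => 0
  feasible : Feasible (x 0) (x 1) (InputEdge x) (inputCap x) (s 3)
  loads : ∀ y ≤ x 1, s 4 y = load (x 0) (x 1) (s 3) y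

theorem Ready.congr {x : ℕ → ℕ} {s t : Store} (h : Ready x s) (h0 : t 0 = s 0) (h1 : t 1 = s 1)
    (h2 : t 2 = s 2) (h3 : t 3 = s 3) (h4 : t 4 = s 4) : Ready x t :=
  ⟨h.tables.congr h0 h2, h1.trans h.output, by rw [h3]; exact h.feasible,
    by rw [h3, h4]; exact h.loads⟩

/-- Every bin is stable for the assignment in memory. -/
def AllStable (x a : ℕ → ℕ) : Prop :=
  ∀ f ≤ x 1, StableAt (x 0) (x 1) (InputEdge x) (inputCap x) a f

namespace ForProg

/-- Adjust the loads of the target bin and of the source bin. -/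
def updateLoads : ForProg :=
  .seq (.write 4 (.var 8) (.add (.read 4 (.var 8)) (.const 1)))
    (.write 4 (.var 13) (.sub (.read 4 (.var 13)) (.const 1)))

/-- Improve the assignment along a path from the source bin, if there is one. -/
def improve : ForProg := .seq search (.seq chooseTarget (.seq walk updateLoads))

/-- If no target is found, the labelled set itself certifies stability at `f`. Otherwise the
potential falls, and since labelled bins lie in every closed set containing `f`, no certificate
exists. The negative clause is what later makes stability persist under further sweeps. -/
theorem improve_spec {x : ℕ → ℕ} {f : ℕ} {s : Store} (hs : Ready x s) (hf : f ≤ x 1)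
    (h13 : s 13 0 = f) :
    Ready x (improve.eval s) ∧
      ((improve.eval s 3 = s 3 ∧
        StableAt (x 0) (x 1) (InputEdge x) (inputCap x) (s 3) f) ∨
        potential (x 0) (x 1) (improve.eval s 3) < potential (x 0) (x 1) (s 3) ∧
          ¬ StableAt (x 0) (x 1) (InputEdge x) (inputCap x) (s 3) f) := by
  obtain ⟨k, hd, hcl⟩ := search_spec hs.tables hs.feasible.le hf h13
  have e1 : ∀ b, search.Avoids b → search.eval s b = s b := fun b h => eval_of_avoids h s
  set s1 := search.eval s with hs1
  have hT := chooseTarget_spec (s := s1) (f := f) ((e1 0 (by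
    simp [search, labelRound, labelRow, labelEdge, Avoids])).trans hs.tables.input)
    (by rw [e1 13 (by simp [search, labelRound, labelRow, labelEdge, Avoids]), h13])
  have e2 : ∀ b, chooseTarget.Avoids b → chooseTarget.eval s1 b = s1 b :=
    fun b h => eval_of_avoids h s1
  set s2 := chooseTarget.eval s1 with hs2
  have r12 : ∀ b, b = 0 ∨ b = 1 ∨ b = 2 ∨ b = 3 ∨ b = 4 ∨ b = 13 → s2 b = s b := by
    rintro b (rfl | rfl | rfl | rfl | rfl | rfl) <;>
    · rw [e2 _ (by simp [chooseTarget, Avoids]),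
        e1 _ (by simp [search, labelRound, labelRow, labelEdge, Avoids])]
  have d2 : s2 5 = s1 5 := e2 5 (by simp [chooseTarget, Avoids])
  have l1 : s1 4 = s 4 := e1 4 (by simp [search, labelRound, labelRow, labelEdge, Avoids])
  obtain ⟨T, hT8⟩ : ∃ T, s2 8 0 = T := ⟨_, rfl⟩
  rw [hT8, l1] at hT
  have hready : Ready x s2 := hs.congr (r12 0 (by simp)) (r12 1 (by simp)) (r12 2 (by simp))
    (r12 3 (by simp)) (r12 4 (by simp))
  have hTle : T ≤ x 1 := by
    rcases hT with ⟨rfl, _⟩ | ⟨g, hg, rfl, _⟩ <;> omega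
  have hdT : s2 5 T ≠ 0 := by
    rw [d2]
    rcases hT with ⟨rfl, _⟩ | ⟨g, hg, rfl, h, _⟩
    · simp [hd.source]
    · exact h
  have hw := walk_spec (f := f) (k := k) hready.tables hready.feasible
    (by rw [r12 3 (by simp), d2]; exact hd) hT8 hTle hdT
  have e3 : ∀ b, walk.Avoids b → walk.eval s2 b = s2 b := fun b h => eval_of_avoids h s2
  have himp : improve.eval s = updateLoads.eval (walk.eval s2) := rfl
  -- The target is incremented before the source is decremented, so the loads are unchanged when
  -- both coincide.
  have hld : improve.eval s 4 = Function.update (Function.update (s 4) T (s 4 T + 1)) f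
      (Function.update (s 4) T (s 4 T + 1) f - 1) := by
    rw [himp]
    simp [updateLoads, eval, Expr.val, e3 4 (by simp [walk, walkRound, moveWorker, Avoids]),
      e3 8 (by simp [walk, walkRound, moveWorker, Avoids]),
      e3 13 (by simp [walk, walkRound, moveWorker, Avoids]), hT8, r12, h13]
  have hrest : ∀ b, b ≠ 4 → improve.eval s b = walk.eval s2 b := fun b hb =>
    eval_of_avoids (P := updateLoads) (by simp [updateLoads, Avoids, hb]) _
  rw [← hrest 3 (by decide), r12 3 (by simp)] at hw
  have hTc : T = f ∨ count (x 0) (s 3) T < inputCap x T := by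
    rcases hT with ⟨rfl, _⟩ | ⟨g, hg, rfl, _, h2, _⟩
    · exact Or.inl rfl
    · rw [hs.loads _ hg.le] at h2
      exact Or.inr (lt_of_le_of_lt (by simp [load]) h2)
  refine ⟨⟨hready.tables.congr ?_ ?_, ?_, hw.feasible hs.feasible hTc, ?_⟩, ?_⟩
  · rw [hrest 0 (by decide), e3 0 (by simp [walk, walkRound, moveWorker, Avoids])]
  · rw [hrest 2 (by decide), e3 2 (by simp [walk, walkRound, moveWorker, Avoids])]
  · rw [hrest 1 (by decide), e3 1 (by simp [walk, walkRound, moveWorker, Avoids]),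
      hready.output]
  · intro y hy
    have h1 := hw.load_eq y
    have h2 := hs.loads y hy
    rw [hld]
    simp only [Function.update_apply]
    split_ifs at * <;> subst_vars <;> first | omega | simp_all
  · rcases hT with ⟨hTf, hst⟩ | ⟨g, hg, hgT, -, h2, h3⟩
    · refine Or.inl ⟨(hw.trivial hTf).1, _, ?_, hcl, fun g hg hgn => ?_⟩
      · simp [hd.source]
      · have := hst g hgn hg
        rw [hs.loads g hgn.le, hs.loads f hf] at this
        simpa [load, hgn.ne] using this
    · subst hgT
      rw [hs.loads T hg.le, hs.loads f hf] at h3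
      refine Or.inr ⟨hw.potential_lt hf hTle h3, fun ⟨R, hfR, hR, hst⟩ => ?_⟩
      have hTR := hd.mem_of_closedBins hs.feasible.le hfR hR _ T hTle rfl (by rwa [← d2])
      have h4 := hst T hTR hg
      rw [hs.loads T hg.le] at h2
      simp only [load, hg.ne, if_false] at h2 h3 h4
      omega

/-- Try all source bins. -/
def sweep : ForProg := .loop 13 (.add .firms (.const 1)) improve

/-- As long as nothing has moved, all certificates concern the same initial assignment; the first
source that moves something shows that this assignment was not stable. -/
theorem sweep_spec {x : ℕ → ℕ} {s : Store} (hs : Ready x s) :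
    Ready x (sweep.eval s) ∧
      ((sweep.eval s 3 = s 3 ∧ AllStable x (s 3)) ∨
        potential (x 0) (x 1) (sweep.eval s 3) < potential (x 0) (x 1) (s 3) ∧
          ¬ AllStable x (s 3)) := by
  have main := loop_induction (c := 13) (P := improve) (s := s) (x 1 + 1)
    (e := .add .firms (.const 1)) (by simp [Expr.val, hs.tables.input])
    (fun i u => Ready x u ∧ ((u 3 = s 3 ∧
      ∀ f < i, StableAt (x 0) (x 1) (InputEdge x) (inputCap x) (s 3) f) ∨
        potential (x 0) (x 1) (u 3) < potential (x 0) (x 1) (s 3) ∧ ¬ AllStable x (s 3)))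
    ⟨hs.congr (by simp) (by simp) (by simp) (by simp) (by simp), by simp⟩
    (by
      rintro f hf u hc - ⟨hu, hinv⟩
      obtain ⟨h1, h2⟩ := improve_spec hu (Nat.lt_succ_iff.mp hf) hc
      refine ⟨h1.congr (by simp) (by simp) (by simp) (by simp) (by simp), ?_⟩
      simp only [Store.set_of_ne _ (show (3 : ℕ) ≠ 13 by decide)]
      rcases hinv with ⟨e, hst⟩ | hlt
      · rw [e] at h2
        refine h2.imp (fun h3 => ⟨h3.1, fun g hg => ?_⟩)
          fun h3 => ⟨h3.1, fun h4 => h3.2 (h4 f (Nat.lt_succ_iff.mp hf))⟩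
        rcases Nat.lt_succ_iff_lt_or_eq.mp hg with hg | rfl
        · exact hst g hg
        · exact h3.2
      · rcases h2 with h2 | h2
        · rw [h2.1]; exact Or.inr hlt
        · exact Or.inr ⟨h2.1.trans hlt.1, hlt.2⟩)
  exact ⟨main.1, main.2.imp (fun h => ⟨h.1, fun f hf => h.2 f (Nat.lt_succ_of_le hf)⟩) id⟩

/-- A bound of the square root of the potential. -/
@[simp] abbrev repeatBound : Expr := .add (.add .workers .workers) (.const 3)

/-- Repeat `sweep` until the assignment is stable. -/
def improveAll : ForProg := .loop 11 repeatBound (.loop 12 repeatBound sweep)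

theorem improveAll_spec {x : ℕ → ℕ} {s : Store} (hs : Ready x s)
    (hp : potential (x 0) (x 1) (s 3) < (2 * x 0 + 3) * (2 * x 0 + 3)) :
    Ready x (improveAll.eval s) ∧ AllStable x (improveAll.eval s 3) := by
  have hN : ∀ u : Store, Ready x u → repeatBound.val u = 2 * x 0 + 3 := by
    intro u hu
    simp [Expr.val, hu.tables.input]; ring
  set N := 2 * x 0 + 3 with hNdef
  let Inv : ℕ → ℕ → Store → Prop := fun i j u => Ready x u ∧ (AllStable x (u 3) ∨
    potential (x 0) (x 1) (u 3) + i * N + j ≤ potential (x 0) (x 1) (s 3))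
  have inner : ∀ i u, Inv i 0 u → Inv i N ((loop 12 repeatBound sweep).eval u) := by
    intro i u hu
    refine loop_induction (s := u) N (hN u hu.1) (Inv i)
      ⟨hu.1.congr (by simp) (by simp) (by simp) (by simp) (by simp), by simpa using hu.2⟩ ?_
    rintro j - v - - ⟨hv, hinv⟩
    obtain ⟨h1, h2⟩ := sweep_spec hv
    refine ⟨h1.congr (by simp) (by simp) (by simp) (by simp) (by simp), ?_⟩
    simp only [Store.set_of_ne _ (show (3 : ℕ) ≠ 12 by decide)]
    rcases h2 with ⟨e, h2⟩ | h2
    · rw [e]; exact Or.inl h2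
    · have hle := hinv.resolve_left h2.2
      exact Or.inr (by omega)
  have main := loop_induction (c := 11) (P := loop 12 repeatBound sweep) (s := s) N (hN s hs)
    (fun i u => Inv i 0 u)
    ⟨hs.congr (by simp) (by simp) (by simp) (by simp) (by simp), by simp⟩
    (by
      rintro i - u - - hinv
      obtain ⟨h1, h2⟩ := inner i u hinv
      refine ⟨h1.congr (by simp) (by simp) (by simp) (by simp) (by simp), ?_⟩
      simp only [Store.set_of_ne _ (show (3 : ℕ) ≠ 11 by decide)]
      refine h2.imp id fun h => ?_
      rw [Nat.succ_mul]; omega)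
  refine ⟨main.1, main.2.resolve_right fun h => ?_⟩
  omega

end ForProg

end NashMatching

/-! ### Initialization, output and the complete program -/

namespace NashMatching

namespace ForProg

/-- Compute the row positions, put all workers into the bin of unmatched workers. -/
def prepare : ForProg :=
  .seq (.write 6 (.const 0) (.add (.const 2) .firms))
    (.seq (.loop 10 .workers
      (.seq (.write 2 (.var 10) (.var 6))
        (.seq (.write 3 (.var 10) .firms) (.write 6 (.const 0) (.add (.var 6) .firms)))))
      (.write 4 .firms (.add (.add .workers .workers) (.const 2))))

/-- Row positions are accumulated by repeated addition, as the machine cannot multiply. Only the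
load of bin `n` is written, namely `m` workers plus the offset `m + 2`; the zeros of fresh memory
are already the loads of the empty firms. -/
theorem prepare_spec {s : Store} (hs : ∀ a ≠ 0, s a = fun _ => 0) :
    Ready (s 0) (prepare.eval s) ∧ ∀ w < s 0 0, prepare.eval s 3 w = s 0 1 := by
  set x := s 0 with hx
  let body : ForProg := .seq (.write 2 (.var 10) (.var 6))
    (.seq (.write 3 (.var 10) .firms) (.write 6 (.const 0) (.add (.var 6) .firms)))
  let lp : ForProg := .loop 10 .workers body
  let u : Store := s.set 6 0 (2 + x 1)
  have main : (∀ w < x 0, lp.eval u 2 w = 2 + x 1 + w * x 1) ∧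
      (∀ w < x 0, lp.eval u 3 w = x 1) ∧ lp.eval u 6 0 = 2 + x 1 + x 0 * x 1 := by
    refine loop_induction (s := u) (x 0) (by simp [Expr.val, u, hx])
      (fun k v => (∀ w < k, v 2 w = 2 + x 1 + w * x 1) ∧ (∀ w < k, v 3 w = x 1) ∧
        v 6 0 = 2 + x 1 + k * x 1) (by simp [u]) ?_
    rintro k - v hc hv ⟨h2, h3, h6⟩
    have e0 : v 0 = x := by rw [hv 0 (by decide) (by simp [body, Avoids])]; simp [u, hx]
    refine ⟨fun w hw => ?_, fun w hw => ?_, ?_⟩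
    · rcases Nat.lt_succ_iff_lt_or_eq.mp hw with hw | rfl
      · simp [body, eval, Expr.val, hc, hw.ne, h2 w hw]
      · simp [body, eval, Expr.val, hc, h6]
    · rcases Nat.lt_succ_iff_lt_or_eq.mp hw with hw | rfl
      · simp [body, eval, Expr.val, hc, hw.ne, h3 w hw]
      · simp [body, eval, Expr.val, hc, e0]
    · simp only [body, eval, Expr.val, hc, h6]
      simp [e0, h6]
      ring
  have hev : prepare.eval s = (ForProg.write 4 .firms
      (.add (.add .workers .workers) (.const 2))).eval (lp.eval u) := rfl
  have hav : ∀ b, b ≠ 2 → b ≠ 3 → b ≠ 6 → b ≠ 10 → lp.eval u b = s b := by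
    intro b h1 h2 h3 h4
    rw [eval_of_avoids (P := lp) (by simp [lp, body, Avoids, h1, h2, h3, h4])]
    exact Store.set_of_ne _ h3 _ _
  have h4 : ∀ b ≠ 4, prepare.eval s b = lp.eval u b := fun b hb => by
    rw [hev]; exact Store.set_of_ne _ hb _ _
  have h44 : prepare.eval s 4 = Function.update (fun _ => 0) (x 1) (x 0 + x 0 + 2) := by
    rw [hev]
    simp [eval, Expr.val, hav, hs, ← hx]
  have h3 : ∀ w < x 0, prepare.eval s 3 w = x 1 := fun w hw => by
    rw [h4 3 (by decide), main.2.1 w hw]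
  have hcount : ∀ y, count (x 0) (prepare.eval s 3) y = if y = x 1 then x 0 else 0 := by
    intro y
    unfold count
    split_ifs with hy
    · rw [Finset.filter_true_of_mem, Finset.card_range]
      intro w hw
      rw [h3 w (by simpa using hw), hy]
    · rw [Finset.filter_false_of_mem, Finset.card_empty]
      intro w hw
      rw [h3 w (by simpa using hw)]
      exact Ne.symm hy
  refine ⟨⟨⟨?_, ?_⟩, ?_, ⟨?_, ?_, ?_⟩, ?_⟩, h3⟩
  · rw [h4 0 (by decide), hav 0 (by decide) (by decide) (by decide) (by decide)]
  · intro w hw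
    rw [h4 2 (by decide), main.1 w hw]
  · rw [h4 1 (by decide), hav 1 (by decide) (by decide) (by decide) (by decide),
      hs 1 (by decide)]
  · intro w hw
    rw [h3 w hw]
  · intro w hw h
    rw [h3 w hw] at h
    omega
  · intro g hg
    rw [hcount g, if_neg hg.ne]
    exact Nat.zero_le _
  · intro y _
    rw [h44, load, hcount, Function.update_apply]
    split_ifs <;> omega

theorem potential_of_unmatched {m n : ℕ} {a : ℕ → ℕ} (ha : ∀ w < m, a w = n) :
    potential m n a < (2 * m + 3) * (2 * m + 3) := by
  have h : ∀ y ∈ Finset.range n, load m n a y ^ 2 = 0 := by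
    intro y hy
    have hyn : y ≠ n := (Finset.mem_range.mp hy).ne
    have : count m a y = 0 := by
      unfold count
      rw [Finset.filter_false_of_mem, Finset.card_empty]
      intro w hw
      rw [ha w (by simpa using hw)]
      exact hyn.symm
    simp [load, this, hyn]
  have h1 := count_le_workers m a n
  have h2 : load m n a n ≤ 2 * m + 2 := by simp only [load, if_true]; omega
  rw [potential, Finset.sum_range_succ, Finset.sum_eq_zero h, zero_add]
  nlinarith

/-- Write the matrix of the assignment. -/
def writeOutput : ForProg :=
  .loop 16 .workers
    (.ite (.sub .firms (.read 3 (.var 16)))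
      (.write 1 (.sub (.add (.read 2 (.var 16)) (.read 3 (.var 16))) (.add (.const 2) .firms))
        (.const 1))
      .skip)

open Classical in
theorem writeOutput_spec {x : ℕ → ℕ} {s : Store} (hs : Ready x s) :
    ∀ i, writeOutput.eval s 1 i =
      if ∃ w < x 0, s 3 w < x 1 ∧ i = w * x 1 + s 3 w then 1 else 0 := by
  refine loop_induction (s := s) (x 0) (by simp [Expr.val, hs.tables.input])
    (fun k u => ∀ i, u 1 i = if ∃ w < k, s 3 w < x 1 ∧ i = w * x 1 + s 3 w then 1 else 0)
    (by simp [hs.output]) fun k hk u hc hu hinv i => ?_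
  have e0 : u 0 = x := by rw [hu 0 (by decide) (by simp [Avoids]), hs.tables.input]
  have e2 : u 2 k = 2 + x 1 + k * x 1 := by
    rw [hu 2 (by decide) (by simp [Avoids]), hs.tables.row k hk]
  have e3 : u 3 = s 3 := hu 3 (by decide) (by simp [Avoids])
  have hex : (∃ w < k + 1, s 3 w < x 1 ∧ i = w * x 1 + s 3 w) ↔
      (∃ w < k, s 3 w < x 1 ∧ i = w * x 1 + s 3 w) ∨ (s 3 k < x 1 ∧ i = k * x 1 + s 3 k) := by
    constructor
    · rintro ⟨w, hw, h⟩
      rcases Nat.lt_succ_iff_lt_or_eq.mp hw with hw | rfl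
      · exact Or.inl ⟨w, hw, h⟩
      · exact Or.inr h
    · rintro (⟨w, hw, h⟩ | h)
      · exact ⟨w, by omega, h⟩
      · exact ⟨k, by omega, h⟩
  rw [Store.set_of_ne _ (by decide)]
  simp only [hex]
  by_cases h : s 3 k < x 1
  -- Row positions in the input are shifted by the `2 + n` cells holding `m`, `n` and the
  -- capacities; the output matrix starts at cell 0.
  · have hpos : 2 + x 1 + k * x 1 + s 3 k - (2 + x 1) = k * x 1 + s 3 k := by omega
    have : x 1 - s 3 k ≠ 0 := by omega
    have hupd : Function.update (u 1) (k * x 1 + s 3 k) 1 i =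
        if (∃ w < k, s 3 w < x 1 ∧ i = w * x 1 + s 3 w) ∨ (s 3 k < x 1 ∧ i = k * x 1 + s 3 k)
        then 1 else 0 := by
      rw [Function.update_apply, hinv i]
      by_cases hi : i = k * x 1 + s 3 k
      · rw [if_pos hi, if_pos (Or.inr ⟨h, hi⟩)]
      · simp only [hi, if_false, and_false, or_false]
    rw [← hupd]
    simp [eval, Expr.val, hc, e0, e3, e2, this, hpos]
  · have : x 1 - s 3 k = 0 := by omega
    simp [eval, Expr.val, hc, e0, e3, this, hinv i, h]

/-- The whole program for instances with at least one firm. -/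
def solve : ForProg := .seq prepare (.seq improveAll writeOutput)

open Classical in
theorem solve_spec {s : Store} (hs : ∀ a ≠ 0, s a = fun _ => 0) :
    ∃ a : ℕ → ℕ, Feasible (s 0 0) (s 0 1) (InputEdge (s 0)) (inputCap (s 0)) a ∧
      AllStable (s 0) a ∧ ∀ i, solve.eval s 1 i =
        if ∃ w < s 0 0, a w < s 0 1 ∧ i = w * s 0 1 + a w then 1 else 0 := by
  obtain ⟨h1, h2⟩ := prepare_spec hs
  obtain ⟨h3, h4⟩ := improveAll_spec h1 (potential_of_unmatched h2)
  exact ⟨_, h3.feasible, h4, writeOutput_spec h3⟩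

theorem solve_wellFormed : solve.WellFormed ∧ solve.Avoids 0 := by
  simp [solve, prepare, improveAll, sweep, improve, search, labelRound, labelRow, labelEdge,
    chooseTarget, walk, walkRound, moveWorker, updateLoads, writeOutput, WellFormed, Avoids,
    Expr.IsBound]

end ForProg

end NashMatching

namespace NashMatching

/-! ## Input and output lists -/

theorem getD_flatten_ofFn {m n : ℕ} (v : Fin m → Fin n → ℕ) (i : ℕ) :
    (List.ofFn fun w => List.ofFn fun f => v w f).flatten.getD i 0 =
      if h : i < m * n then v (Fin.divNat ⟨i, h⟩) (Fin.modNat ⟨i, h⟩) else 0 := by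
  have : (List.ofFn fun w => List.ofFn fun f => v w f).flatten =
      List.ofFn fun k : Fin (m * n) => v k.divNat k.modNat := by
    rw [List.ofFn_mul]
    congr 2
    funext w
    congr 1
    funext f
    congr 1
    · ext
      simp only [Fin.divNat]
      rw [mul_comm, Nat.mul_add_div (f.pos), Nat.div_eq_of_lt f.2, add_zero]
    · ext
      simp only [Fin.modNat]
      rw [mul_comm, Nat.mul_add_mod, Nat.mod_eq_of_lt f.2]
  rw [this, List.getD_eq_getElem?_getD, List.getElem?_ofFn]
  split_ifs <;> rfl

theorem getD_flatten_ofFn_mul_add {m n : ℕ} (v : Fin m → Fin n → ℕ) (w : Fin m) (f : Fin n) :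
    (List.ofFn fun w => List.ofFn fun f => v w f).flatten.getD (w * n + f) 0 = v w f := by
  have h : (w : ℕ) * n + f < m * n := by
    calc (w : ℕ) * n + f < w * n + n := by omega
      _ = (w + 1) * n := by ring
      _ ≤ m * n := Nat.mul_le_mul_right n w.2
  rw [getD_flatten_ofFn, dif_pos h]
  congr 1
  · ext
    simp only [Fin.divNat]
    rw [mul_comm, Nat.mul_add_div (f.pos), Nat.div_eq_of_lt f.2, add_zero]
  · ext
    simp only [Fin.modNat]
    rw [mul_comm, Nat.mul_add_mod, Nat.mod_eq_of_lt f.2]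

namespace Instance

variable (I : Instance)

theorem length_encode : I.encode.length = 2 + I.n + I.m * I.n + I.n * I.m := by
  simp [encode, List.length_flatten, Function.comp_def, List.map_ofFn]
  omega

theorem encode_zero : I.encode.getD 0 0 = I.m := rfl

theorem encode_one : I.encode.getD 1 0 = I.n := rfl

theorem encode_cap (f : Fin I.n) : I.encode.getD (2 + f) 0 = I.cap f := by
  rw [encode, List.getD_append _ _ _ _ (by simp; omega), List.getD_append _ _ _ _ (by simp; omega),
    List.getD_append_right _ _ _ _ (by simp)]
  simp

theorem encode_vW (w : Fin I.m) (f : Fin I.n) :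
    I.encode.getD (2 + I.n + w * I.n + f) 0 = I.vW w f := by
  have h : (w : ℕ) * I.n + f < I.m * I.n := by
    calc (w : ℕ) * I.n + f < w * I.n + I.n := by omega
      _ = (w + 1) * I.n := by ring
      _ ≤ I.m * I.n := Nat.mul_le_mul_right I.n w.2
  rw [encode, List.getD_append _ _ _ _ (by
      simp [List.length_flatten, Function.comp_def, List.map_ofFn]; omega),
    List.getD_append_right _ _ _ _ (by simp; omega), ← getD_flatten_ofFn_mul_add I.vW w f]
  congr 1
  simp
  omega

/-- Each number contributes at least its separator, so the bit length is at least the length of the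
list, and with a firm present that length is at least `m`. -/
theorem le_bitSize (hn : I.n ≠ 0) : I.m ≤ bitSize I.encode ∧ I.n ≤ bitSize I.encode := by
  have h : ∀ x : List ℕ, x.length ≤ bitSize x := by
    intro x
    induction x with
    | nil => simp [bitSize]
    | cons k x ih => simp only [bitSize, List.map_cons, List.sum_cons, List.length_cons] at ih ⊢; omega
  have h1 := h I.encode
  rw [length_encode] at h1
  have h2 : I.m ≤ I.m * I.n := Nat.le_mul_of_pos_right _ (Nat.pos_of_ne_zero hn)
  omega

/-- The matching of an assignment. -/
def ofAssignment (a : ℕ → ℕ) (w : Fin I.m) (f : Fin I.n) : ℕ := if a w = f then 1 else 0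

open Classical in
theorem getD_encodeMatching (a : ℕ → ℕ) (i : ℕ) :
    (I.encodeMatching (I.ofAssignment a)).getD i 0 =
      if ∃ w < I.m, a w < I.n ∧ i = w * I.n + a w then 1 else 0 := by
  split_ifs with h
  · obtain ⟨w, hw, ha, rfl⟩ := h
    have := getD_flatten_ofFn_mul_add (I.ofAssignment a) ⟨w, hw⟩ ⟨a w, ha⟩
    simpa [ofAssignment, encodeMatching] using this
  · rw [encodeMatching, getD_flatten_ofFn]
    split_ifs with hi
    · refine if_neg fun h1 => h ⟨_, (Fin.divNat ⟨i, hi⟩).2, ?_⟩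
      rw [h1]
      refine ⟨(Fin.modNat _).2, ?_⟩
      simp only [Fin.divNat, Fin.modNat]
      rw [mul_comm, Nat.div_add_mod]
    · rfl

/-! ## Nash optimality of stable assignments -/

theorem sum_ofAssignment_workers (a : ℕ → ℕ) (f : Fin I.n) :
    ∑ w, I.ofAssignment a w f = count I.m a f := by
  rw [count, Finset.card_filter, Finset.sum_range]
  rfl

theorem isMatching_ofAssignment {E : ℕ → ℕ → Prop} {cap a : ℕ → ℕ}
    (ha : Feasible I.m I.n E cap a) (hcap : ∀ f : Fin I.n, cap f = I.cap f) :
    I.IsMatching (I.ofAssignment a) where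
  zero_or_one w f := by
    unfold ofAssignment
    split_ifs <;> simp
  worker_le w := by
    simp only [ofAssignment]
    rw [← Finset.card_filter, Finset.card_le_one]
    intro f hf g hg
    rw [Finset.mem_filter] at hf hg
    exact Fin.ext (hf.2.symm.trans hg.2)
  firm_le f := by
    rw [sum_ofAssignment_workers, ← hcap]
    exact ha.count_le f f.2

variable {I}

/-- Nonzero utility gives each worker a valued firm, and the bound of one firm per worker makes it
the only one, so the matrix is the graph of a function. -/
theorem IsMatching.exists_assignment {ν : Fin I.m → Fin I.n → ℕ} (hν : I.IsMatching ν)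
    (h : ∀ w, I.workerUtility ν w ≠ 0) :
    ∃ b : ℕ → ℕ, (∀ w : Fin I.m, ∃ f : Fin I.n, b w = f ∧ I.vW w f ≠ 0) ∧
      ν = I.ofAssignment b := by
  have h1 : ∀ w, ∃ f, I.vW w f * ν w f ≠ 0 := fun w => by
    obtain ⟨f, -, hf⟩ := Finset.exists_ne_zero_of_sum_ne_zero (h w)
    exact ⟨f, hf⟩
  choose b hb using h1
  refine ⟨fun w => if hw : w < I.m then b ⟨w, hw⟩ else 0,
    fun w => ⟨b w, by simp, left_ne_zero_of_mul (hb w)⟩, ?_⟩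
  funext w f
  have hb1 : ν w (b w) = 1 := (hν.zero_or_one w (b w)).resolve_left (right_ne_zero_of_mul (hb w))
  simp only [ofAssignment, Fin.is_lt, dite_true, Fin.eta, Fin.val_inj]
  split_ifs with hf
  · rw [← hf, hb1]
  · have h2 := hν.worker_le w
    have h3 : ν w f + ν w (b w) ≤ ∑ g, ν w g := by
      rw [← Finset.sum_pair (Ne.symm hf)]
      exact Finset.sum_le_sum_of_subset (Finset.subset_univ _)
    omega

theorem firmUtility_ofAssignment {a : ℕ → ℕ} {f : Fin I.n}
    (h : ∀ w : Fin I.m, a w = f → I.vF f w = 1) :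
    I.firmUtility (I.ofAssignment a) f = count I.m a f := by
  rw [← sum_ofAssignment_workers]
  refine Finset.sum_congr rfl fun w _ => ?_
  unfold ofAssignment
  split_ifs with hw
  · rw [h w hw]
  · rfl

theorem workerUtility_ofAssignment {a : ℕ → ℕ} {w : Fin I.m} {f : Fin I.n} (hf : a w = f)
    (h : I.vW w f = 1) : I.workerUtility (I.ofAssignment a) w = 1 := by
  rw [workerUtility, Finset.sum_eq_single f]
  · simp [ofAssignment, hf, h]
  · intro g _ hg
    simp [ofAssignment, hf, Fin.val_inj, hg.symm]
  · simp

/-- A competitor of welfare zero is harmless. Any other one matches all workers along edges and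
leaves no firm empty, so both welfare products become products of bin sizes. -/
theorem nashOptimal_of_stableAt (hI : I.SymmetricBinary) {E : ℕ → ℕ → Prop} {cap a : ℕ → ℕ}
    (hE : ∀ (w : Fin I.m) (f : Fin I.n), E w f ↔ I.vW w f ≠ 0)
    (hcap : ∀ f : Fin I.n, cap f = I.cap f) (ha : Feasible I.m I.n E cap a)
    (hs : ∀ f ≤ I.n, StableAt I.m I.n E cap a f) : I.NashOptimal (I.ofAssignment a) := by
  have hW : ∀ (w : Fin I.m) (f : Fin I.n), E w f → I.vW w f = 1 ∧ I.vF f w = 1 := fun w f h =>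
    (hI w f).resolve_right fun h1 => (hE w f).mp h h1.1
  refine ⟨I.isMatching_ofAssignment ha hcap, fun ν hν => ?_⟩
  unfold nashWelfare
  have hcast : ∀ μ : Fin I.m → Fin I.n → ℕ,
      (∏ w, (I.workerUtility μ w : ℝ)) * ∏ f, (I.firmUtility μ f : ℝ) =
        (((∏ w, I.workerUtility μ w) * ∏ f, I.firmUtility μ f : ℕ) : ℝ) := by
    intro μ; push_cast; rfl
  rw [hcast, hcast]
  refine Real.rpow_le_rpow (Nat.cast_nonneg _) (Nat.cast_le.mpr ?_) (by positivity)
  by_cases h0 : (∏ w, I.workerUtility ν w) * ∏ f, I.firmUtility ν f = 0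
  · rw [h0]; exact Nat.zero_le _
  obtain ⟨h1, h2⟩ := mul_ne_zero_iff.mp h0
  rw [Finset.prod_ne_zero_iff] at h1 h2
  obtain ⟨b, hb, rfl⟩ := hν.exists_assignment fun w => h1 w (Finset.mem_univ w)
  have hbE : ∀ w < I.m, b w < I.n ∧ E w (b w) := fun w hw => by
    obtain ⟨f, hf, hv⟩ := hb ⟨w, hw⟩
    simp only at hf
    rw [hf]
    exact ⟨f.2, (hE ⟨w, hw⟩ f).mpr hv⟩
  have hfirm : ∀ c : ℕ → ℕ, (∀ w < I.m, c w < I.n ∧ E w (c w)) →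
      (∏ w, I.workerUtility (I.ofAssignment c) w) * ∏ f, I.firmUtility (I.ofAssignment c) f =
        ∏ g ∈ Finset.range I.n, count I.m c g := by
    intro c hc
    rw [Finset.prod_eq_one, one_mul, Finset.prod_range]
    · refine Finset.prod_congr rfl fun f _ => firmUtility_ofAssignment fun w hw => ?_
      exact (hW w f (hw ▸ (hc w w.2).2)).2
    · intro w _
      exact workerUtility_ofAssignment (f := ⟨c w, (hc w w.2).1⟩) rfl
        (hW w ⟨c w, (hc w w.2).1⟩ (hc w w.2).2).1
  have hbc : ∀ g < I.n, count I.m b g ≤ cap g := fun g hg => by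
    have := hν.firm_le ⟨g, hg⟩
    rwa [sum_ofAssignment_workers, ← hcap] at this
  have hb1 : ∀ g < I.n, 1 ≤ count I.m b g := fun g hg => by
    have := h2 ⟨g, hg⟩ (Finset.mem_univ _)
    rw [firmUtility_ofAssignment fun w hw => (hW w ⟨g, hg⟩ (hw ▸ (hbE w w.2).2)).2] at this
    exact Nat.one_le_iff_ne_zero.mpr this
  have hlt := ha.lt_of_stableAt (hs I.n le_rfl) hbE hbc
  rw [hfirm b hbE, hfirm a fun w hw => ⟨hlt w hw, ha.edge w hw (hlt w hw)⟩]
  exact ha.prod_count_le hs hbE hbc hb1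

theorem nashOptimal_of_no_firms (hn : I.n = 0) (μ : Fin I.m → Fin I.n → ℕ) : I.NashOptimal μ := by
  have : IsEmpty (Fin I.n) := by rw [hn]; infer_instance
  have hμ : ∀ ν : Fin I.m → Fin I.n → ℕ, ν = μ := fun ν => by funext w f; exact isEmptyElim f
  refine ⟨⟨fun _ f => isEmptyElim f, fun w => by simp, fun f => isEmptyElim f⟩, fun ν _ => ?_⟩
  rw [hμ ν]

end Instance

end NashMatching

theorem mainTheorem10 :
    NashMatching.SolvableInPolyTime
      {I : NashMatching.Instance | I.SymmetricBinary}
      NashMatching.Instance.encode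
      (fun I y => ∃ μ : Fin I.m → Fin I.n → ℕ, I.NashOptimal μ ∧ y = I.encodeMatching μ) := by
  open NashMatching in
  -- Without firms the input is just `m` and `n` in binary, and loops up to `m` could take
  -- exponential time; the test sends this case to the empty output. The constant 4 covers the test
  -- and `skip`.
  refine ⟨.ite .firms ForProg.solve.compile .skip, ForProg.solve.cost + 4, fun I hI => ?_⟩
  set s := inputStore I.encode with hs
  have hs0 : ∀ i, s 0 i = I.encode.getD i 0 := fun i => if_pos rfl
  have hm : s 0 0 = I.m := by rw [hs0, I.encode_zero]
  have hn : s 0 1 = I.n := by rw [hs0, I.encode_one]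
  by_cases h0 : I.n = 0
  · refine ⟨_, s, I.encodeMatching fun _ _ => 0, .ite_false (by simpa [Expr.val, hn] using h0)
      (.skip s), ?_, ?_, _, Instance.nashOptimal_of_no_firms h0 _, rfl⟩
    · simp [Expr.time]
    · intro i
      rw [Instance.encodeMatching, getD_flatten_ofFn]
      simp [h0, hs, inputStore]
  · obtain ⟨hmL, hnL⟩ := I.le_bitSize h0
    obtain ⟨t, hr, ht⟩ := ForProg.runs_compile ForProg.solve_wellFormed.1
      ForProg.solve_wellFormed.2 (hm.trans_le hmL) (hn.trans_le hnL)
    obtain ⟨a, ha, hst, hout⟩ := ForProg.solve_spec (s := s) fun b hb => by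
      funext i; simp [hs, inputStore, hb]
    refine ⟨_, _, I.encodeMatching (I.ofAssignment a),
      .ite_true (by simpa [Expr.val, hn] using h0) hr, ?_, fun i => ?_, _, ?_, rfl⟩
    · simp [Expr.time]; omega
    · rw [hout, I.getD_encodeMatching, hm, hn]
    · unfold AllStable at hst
      rw [hm, hn] at ha hst
      refine Instance.nashOptimal_of_stableAt hI (fun w f => ?_) (fun f => ?_) ha hst
      · rw [InputEdge, hs0, hn, I.encode_vW]
      · rw [inputCap, hs0, I.encode_cap]
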